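/- Let $\theta\in(0,1)$ be irrational, with continued fraction $\theta=[a_1,a_2,\dots]$: $\theta_1^{*}=1/\theta$, $a_n=\lfloor\theta_n^{*}\rfloor$, $\theta_{n+1}^{*}=1/(\theta_n^{*}-a_n)$. Let $p_n/q_n$ be its convergents, given by $p_0=0$, $p_1=1$, $q_0=1$, $q_1=a_1$, $p_n=a_np_{n-1}+p_{n-2}$, $q_n=a_nq_{n-1}+q_{n-2}$ for $n\ge 2$, and put $\theta_n=p_n/q_n$. Let $A_\theta$ be the universal C*-algebra generated by two unitaries $U_\theta,V_\theta$ with $U_\theta V_\theta=e^{2\pi i\theta}V_\theta U_\theta$. For $n\ge 0$ let $u_{\theta_n},v_{\theta_n}\in M_{q_n}(\mathbb C)$ be the cyclic permutation matrix with entries $1$ on the superdiagonal and in the lower left corner and $0$ elsewhere (for $q_n=1$: $u_{\theta_n}=(1)$), and the diagonal matrix $\mathrm{diag}(1,\omega,\omega^2,\dots,\omega^{q_n-1})$ with $\omega=e^{2\pi i p_n/q_n}$. Let $\alpha_1,\alpha_{-1},\beta_1,\beta_{-1}\in\mathbb C$, $M=\max\{|\alpha_1|,|\alpha_{-1}|,|\beta_1|,|\beta_{-1}|\}$,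 and $$H_\theta=\alpha_1U_\theta+\alpha_{-1}U_\theta^*+\beta_1V_\theta+\beta_{-1}V_\theta^*,\qquad h_{\theta_n}=\alpha_1u_{\theta_n}+\alpha_{-1}u_{\theta_n}^*+\beta_1v_{\theta_n}+\beta_{-1}v_{\theta_n}^*.$$ For $\varepsilon>0$ and an element $T$ of a unital C*-algebra (matrices carry the operator norm) let $\sigma^{(\varepsilon)}(T)=\{\lambda\in\mathbb C:\|(\lambda-T)^{-1}\|\ge 1/\varepsilon\}$, where $\|X^{-1}\|=\infty$ if $X$ is not invertible. For $n\ge 1$ put $\varepsilon_n=204M\left(\frac1{q_{n-1}}+\frac1{q_n}\right)$. Then for every $n\ge1$: (1) For every $\varepsilon>0$, $$\sigma^{(\varepsilon)}(h_{\theta_{n-1}})\cup\sigma^{(\varepsilon)}(h_{\theta_n})\subset\sigma^{(\varepsilon+\varepsilon_n)}(H_\theta)\subset\sigma^{(\varepsilon+2\varepsilon_n)}(h_{\theta_{n-1}})\cup\sigma^{(\varepsilon+2\varepsilon_n)}(h_{\theta_n}).$$ (2) If $h_{\theta_{n-1}}$, $h_{\theta_n}$ and $H_\theta$ are all normal, then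 $$d_H\big(\sigma(h_{\theta_{n-1}})\cup\sigma(h_{\theta_n}),\ \sigma(H_\theta)\big)\le 204M\left(\frac1{q_{n-1}}+\frac1{q_n}\right),$$ where $d_H$ is the Hausdorff distance between compact subsets of $\mathbb C$. -/

import Mathlib

open scoped ENNReal Matrix.Norms.L2Operator

noncomputable section

namespace RotationSpectra

/-! ### Continued fractions -/

/-- The complete quotients of `θ ∈ (0,1)`: `θ` itself at index `0` and, from index `1` on,
`θ₁ = 1 / θ` and `θ_{n+1} = 1 / (θ_n - ⌊θ_n⌋)`. (For `θ ∈ (0,1)` one has `⌊θ⌋ = 0`, so the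
recursion gives `θ₁ = 1 / θ`.) -/
def completeQuotient (θ : ℝ) : ℕ → ℝ
  | 0 => θ
  | n + 1 => 1 / (completeQuotient θ n - ⌊completeQuotient θ n⌋)

/-- The partial quotients `a_n = ⌊θ_n⌋`, `n ≥ 1` (they are positive integers for irrational
`θ ∈ (0,1)`). -/
def partialQuotient (θ : ℝ) (n : ℕ) : ℕ :=
  ⌊completeQuotient θ n⌋₊

/-- Numerators of the convergents: `p₀ = 0`, `p₁ = 1`, `p_n = a_n p_{n-1} + p_{n-2}`. -/
def convNum (θ : ℝ) : ℕ → ℕ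
  | 0 => 0
  | 1 => 1
  | n + 2 => partialQuotient θ (n + 2) * convNum θ (n + 1) + convNum θ n

/-- Denominators of the convergents: `q₀ = 1`, `q₁ = a₁`, `q_n = a_n q_{n-1} + q_{n-2}`. -/
def convDen (θ : ℝ) : ℕ → ℕ
  | 0 => 1
  | 1 => partialQuotient θ 1
  | n + 2 => partialQuotient θ (n + 2) * convDen θ (n + 1) + convDen θ n

/-! ### The matrices `u_{p/q}` and `v_{p/q}` -/

/-- The `q × q` cyclic permutation matrix with ones above the diagonal and in the lower left
corner. -/
def matU (q : ℕ) : Matrix (Fin q) (Fin q) ℂ :=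
  Matrix.of fun i j => if (i.val + 1) % q = j.val then 1 else 0

/-- The diagonal matrix `diag(1, ω, ω², …, ω^{q-1})` with `ω = e^{2πi p/q}`. -/
def matV (p q : ℕ) : Matrix (Fin q) (Fin q) ℂ :=
  Matrix.diagonal fun j =>
    Complex.exp (2 * (Real.pi : ℂ) * Complex.I * ((p : ℂ) / (q : ℂ))) ^ j.val

/-! ### The universal rotation algebra -/

/-- A pair of unitaries `U, V` in a nonzero unital C*-algebra with `U V = e^{2πiθ} V U`. -/
structure RotationPair (θ : ℝ) : Type 1 where
  carrier : Type
  [cstar : CStarAlgebra carrier]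
  [nontriv : Nontrivial carrier]
  U : carrier
  V : carrier
  U_mem : U ∈ unitary carrier
  V_mem : V ∈ unitary carrier
  comm : U * V = Complex.exp (2 * (Real.pi : ℂ) * Complex.I * (θ : ℂ)) • (V * U)

attribute [instance] RotationPair.cstar RotationPair.nontriv

instance lpCStarAlgebra {ι : Type*} (A : ι → Type*) [∀ i, CStarAlgebra (A i)]
    [∀ i, Nontrivial (A i)] : CStarAlgebra (lp A ∞) where

/-- The C*-algebra of bounded families indexed by all pairs of unitaries satisfying the rotation
relation. -/
abbrev RotationProduct (θ : ℝ) : Type 1 :=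
  lp (fun i : RotationPair θ => i.carrier) ∞

/-- The direct sum of all the `U`s. -/
def prodU (θ : ℝ) : RotationProduct θ :=
  ⟨fun i => i.U, memℓp_infty ⟨1, by
    rintro _ ⟨i, rfl⟩
    exact CStarRing.norm_of_mem_unitary i.U_mem |>.le⟩⟩

/-- The direct sum of all the `V`s. -/
def prodV (θ : ℝ) : RotationProduct θ :=
  ⟨fun i => i.V, memℓp_infty ⟨1, by
    rintro _ ⟨i, rfl⟩
    exact CStarRing.norm_of_mem_unitary i.V_mem |>.le⟩⟩

/-- The closed unital *-subalgebra generated by the universal pair. -/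
def rotationSubalgebra (θ : ℝ) : StarSubalgebra ℂ (RotationProduct θ) :=
  (StarAlgebra.adjoin ℂ {prodU θ, prodV θ}).topologicalClosure

instance (θ : ℝ) : IsClosed (rotationSubalgebra θ : Set (RotationProduct θ)) :=
  StarSubalgebra.isClosed_topologicalClosure _

/-- The rotation algebra `A_θ`: the universal C*-algebra generated by two unitaries with
`U V = e^{2πiθ} V U`, realised as the C*-algebra generated by the direct sum of all such pairs. The
theorems below show that it has the defining universal property. (A pair generates a separable
C*-algebra, which has at most continuum many elements, so pairs living in `Type` are enough.) -/
def RotationAlgebra (θ : ℝ) : Type 1 :=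
  rotationSubalgebra θ

instance (θ : ℝ) : CStarAlgebra (RotationAlgebra θ) :=
  StarSubalgebra.cstarAlgebra (rotationSubalgebra θ)

/-- The inclusion of `A_θ` into the product algebra. -/
def RotationAlgebra.incl {θ : ℝ} (x : RotationAlgebra θ) : RotationProduct θ :=
  Subtype.val (p := (· ∈ rotationSubalgebra θ)) x

/-- The canonical generator `U_θ`. -/
def genU (θ : ℝ) : RotationAlgebra θ :=
  ⟨prodU θ, StarSubalgebra.le_topologicalClosure _
    (StarAlgebra.subset_adjoin ℂ _ (Set.mem_insert _ _))⟩

/-- The canonical generator `V_θ`. -/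
def genV (θ : ℝ) : RotationAlgebra θ :=
  ⟨prodV θ, StarSubalgebra.le_topologicalClosure _
    (StarAlgebra.subset_adjoin ℂ _ (Set.mem_insert_of_mem _ rfl))⟩

theorem genU_mem_unitary (θ : ℝ) : genU θ ∈ unitary (RotationAlgebra θ) := by
  rw [Unitary.mem_iff]
  constructor <;> apply Subtype.ext <;> apply Subtype.ext <;> funext i
  · exact (Unitary.mem_iff.mp i.U_mem).1
  · exact (Unitary.mem_iff.mp i.U_mem).2

theorem genV_mem_unitary (θ : ℝ) : genV θ ∈ unitary (RotationAlgebra θ) := by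
  rw [Unitary.mem_iff]
  constructor <;> apply Subtype.ext <;> apply Subtype.ext <;> funext i
  · exact (Unitary.mem_iff.mp i.V_mem).1
  · exact (Unitary.mem_iff.mp i.V_mem).2

theorem gen_comm (θ : ℝ) :
    genU θ * genV θ =
      Complex.exp (2 * (Real.pi : ℂ) * Complex.I * (θ : ℂ)) • (genV θ * genU θ) := by
  apply Subtype.ext
  apply Subtype.ext
  funext i
  exact i.comm

/-- Evaluation of `A_θ` at one of the pairs. -/
def evalHom {θ : ℝ} (i : RotationPair θ) : RotationAlgebra θ →⋆ₐ[ℂ] i.carrier where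
  toFun x := x.incl i
  map_one' := rfl
  map_mul' _ _ := rfl
  map_zero' := rfl
  map_add' _ _ := rfl
  commutes' _ := rfl
  map_star' _ := rfl

/-- The universal property: for all unitaries `U, V` of a nonzero C*-algebra with
`U V = e^{2πiθ} V U` there is a unique *-homomorphism with `U_θ ↦ U` and `V_θ ↦ V`. -/
theorem existsUnique_hom {θ : ℝ} (i : RotationPair θ) :
    ∃! φ : RotationAlgebra θ →⋆ₐ[ℂ] i.carrier, φ (genU θ) = i.U ∧ φ (genV θ) = i.V := by
  refine ⟨evalHom i, ⟨rfl, rfl⟩, ?_⟩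
  rintro ψ ⟨hU, hV⟩
  refine StarAlgHom.ext_topologicalClosure
    (S := StarAlgebra.adjoin ℂ {prodU θ, prodV θ})
    (AddMonoidHomClass.continuous_of_bound ψ 1 fun x => by
      simpa using NonUnitalStarAlgHom.norm_apply_le ψ x)
    (AddMonoidHomClass.continuous_of_bound (evalHom i) 1 fun x => by
      simpa using NonUnitalStarAlgHom.norm_apply_le (evalHom i) x) ?_
  refine StarAlgHom.ext_adjoin ?_
  rintro ⟨x, hx'⟩ (hx | hx)
  · obtain rfl : x = prodU θ := hx
    exact hU
  · obtain rfl : x = prodV θ := hx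
    exact hV

/-! ### Spectral quantities and the operators -/

/-- The `ε`-pseudospectrum `{λ : ‖(λ - T)⁻¹‖ ≥ 1/ε}`, with `‖(λ - T)⁻¹‖ = ∞` when `λ - T` is not
invertible. -/
def pseudospectrum {A : Type*} [NormedRing A] [NormedAlgebra ℂ A] (ε : ℝ) (T : A) : Set ℂ :=
  {z | ¬ IsUnit (algebraMap ℂ A z - T) ∨ 1 / ε ≤ ‖Ring.inverse (algebraMap ℂ A z - T)‖}

/-- `α₁ u + α₋₁ u* + β₁ v + β₋₁ v*`, where `α₁'`, `β₁'` stand for `α₋₁`, `β₋₁`. -/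
def hamiltonian {A : Type*} [Ring A] [StarRing A] [Algebra ℂ A] (α₁ α₁' β₁ β₁' : ℂ) (u v : A) : A :=
  α₁ • u + α₁' • star u + β₁ • v + β₁' • star v

/-- The operator `H_θ` in the rotation algebra. -/
def opH (θ : ℝ) (α₁ α₁' β₁ β₁' : ℂ) : RotationAlgebra θ :=
  hamiltonian α₁ α₁' β₁ β₁' (genU θ) (genV θ)

/-- The matrix model `h_{θ_n}`, `θ_n = p_n / q_n`. -/
def matH (θ : ℝ) (α₁ α₁' β₁ β₁' : ℂ) (n : ℕ) : Matrix (Fin (convDen θ n)) (Fin (convDen θ n)) ℂ :=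
  hamiltonian α₁ α₁' β₁ β₁' (matU (convDen θ n)) (matV (convNum θ n) (convDen θ n))

/-- `ε_n = 204 M (1/q_{n-1} + 1/q_n)`, where `M` is the largest modulus of a coefficient. -/
def errBound (θ : ℝ) (α₁ α₁' β₁ β₁' : ℂ) (n : ℕ) : ℝ :=
  204 * max (max ‖α₁‖ ‖α₁'‖) (max ‖β₁‖ ‖β₁'‖) *
    (1 / (convDen θ (n - 1) : ℝ) + 1 / (convDen θ n : ℝ))

end RotationSpectra

end

noncomputable section

namespace RotationSpectra

/-! ### Pseudospectra and approximately multiplicative maps -/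

/-! The two algebras are compared through unital contractive *-linear maps that are almost
multiplicative on the generators. Suppose `Φ : C → B` satisfies `Φ(xu) ≈ Φ(x)U` and `Φ(xv) ≈ Φ(x)V`
up to `c‖x‖`. Applied to a resolvent `x = (z - h)⁻¹` in `C`, it gives an approximate two-sided
inverse `Φ(x)` of `z - H` in `B`, with error `4Mc‖x‖`. A Neumann argument makes `z - H` invertible
with controlled inverse, so the pseudospectrum of `H` lies in that of `h` with `ε` enlarged by `4Mc`
(`IsApproxHom.pseudospectrum_subset`).

Such maps come from a window on `[0,q)²` (`exists_isApproxHom`). Represent `C` on a Hilbert space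
with orthonormal vectors `ξ_{jk}` which `u` and `v` shift down, `v` with a phase `ζ'^j`. Put `J_{jk}
= f(j) f(k) V^k U^j` and `Φ(x) = ∑ ⟨ξ_s, π(x) ξ_t⟩ J_s^* J_t`. Right multiplication by `U` or `V`
shifts the window, so the defect is governed by the discrete gradient of `f` and by `|ζ'^j - ζ^j|`.
The first is `O(1/q)` in `ℓ²` for a parabola. The second is at most `2πj|θ_n - θ| ≤ 7/q`, since
convergents approximate `θ` within `1/q²`. A Cauchy-Schwarz inequality for Gram matrices
(`norm_sum_inner_smul_le`) turns these into operator norms and yields `c = 11/q`.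

The construction runs both ways: from matrices to `A_θ`, with Weyl matrices in Hilbert-Schmidt
space, and from `A_θ` to matrices, with basis vectors of `ℓ²(ℤ²)`. Each convergent alone gives the
error `44M/q`, well within `ε_n`. For normal elements an `ε`-pseudospectrum lies within distance `ε`
of the spectrum, and letting `ε → 0` gives the Hausdorff bound. -/

theorem notMem_pseudospectrum_iff {A : Type*} [NormedRing A] [NormedAlgebra ℂ A] {ε : ℝ} {T : A}
    {z : ℂ} : z ∉ pseudospectrum ε T ↔ IsUnit (algebraMap ℂ A z - T) ∧
      ‖Ring.inverse (algebraMap ℂ A z - T)‖ < 1 / ε := by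
  simp [pseudospectrum]

/-- An approximate inverse of small norm on both sides forces invertibility. -/
theorem isUnit_and_norm_inverse_le {A : Type*} [NormedRing A] [NormOneClass A] [CompleteSpace A]
    {a r : A} {ρ s : ℝ} (hρ : ‖r‖ ≤ ρ) (hs : s < 1) (hl : ‖1 - r * a‖ ≤ s)
    (hr : ‖1 - a * r‖ ≤ s) : IsUnit a ∧ ‖Ring.inverse a‖ ≤ ρ / (1 - s) := by
  have hl' : IsUnit (r * a) := by
    have := isUnit_one_sub_of_norm_lt_one (hl.trans_lt hs)
    simpa using this
  have hr' : IsUnit (a * r) := by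
    have := isUnit_one_sub_of_norm_lt_one (hr.trans_lt hs)
    simpa using this
  obtain ⟨x, hx⟩ := hl'
  obtain ⟨y, hy⟩ := hr'
  have h1 : (↑x⁻¹ * r) * a = 1 := by rw [mul_assoc, ← hx]; simp
  have h2 : a * (r * ↑y⁻¹) = 1 := by rw [← mul_assoc, ← hy]; simp
  have ha : IsUnit a := by
    have h3 : ↑x⁻¹ * r = r * ↑y⁻¹ := left_inv_eq_right_inv h1 h2
    exact ⟨⟨a, _, by rw [h3]; exact h2, h1⟩, rfl⟩
  refine ⟨ha, ?_⟩
  set b := Ring.inverse a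
  have hb : b = r + (1 - r * a) * b := by
    have : a * b = 1 := Ring.mul_inverse_cancel a ha
    rw [sub_mul, mul_assoc, this]; simp
  have h4 : ‖b‖ ≤ ρ + s * ‖b‖ := by
    calc ‖b‖ = ‖r + (1 - r * a) * b‖ := by rw [← hb]
      _ ≤ ‖r‖ + ‖(1 - r * a) * b‖ := norm_add_le _ _
      _ ≤ ‖r‖ + ‖1 - r * a‖ * ‖b‖ := by gcongr; exact norm_mul_le _ _
      _ ≤ ρ + s * ‖b‖ := by gcongr
  rw [le_div_iff₀ (by linarith)]
  linarith

/-- A unital contractive *-linear map which is multiplicative up to `c` with respect to the pairs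
`u, v` and `U, V`. -/
structure IsApproxHom {C B : Type*} [CStarAlgebra C] [CStarAlgebra B] (Φ : C →ₗ[ℂ] B)
    (u v : C) (U V : B) (c : ℝ) : Prop where
  map_one : Φ 1 = 1
  map_star : ∀ x, Φ (star x) = star (Φ x)
  norm_le : ∀ x, ‖Φ x‖ ≤ ‖x‖
  right_u : ∀ x, ‖Φ (x * u) - Φ x * U‖ ≤ c * ‖x‖
  right_v : ∀ x, ‖Φ (x * v) - Φ x * V‖ ≤ c * ‖x‖

section ApproxHom

variable {C B : Type*} [CStarAlgebra C] [CStarAlgebra B]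

/-- Apply the bound for `u` to `x * star u` and multiply the difference by the unitary `U`; neither
changes a norm. -/
theorem norm_map_mul_star_sub_le [Nontrivial C] [Nontrivial B] {Φ : C →ₗ[ℂ] B} {u : C} {U : B}
    {c : ℝ} (hu : u ∈ unitary C) (hU : U ∈ unitary B)
    (h : ∀ x, ‖Φ (x * u) - Φ x * U‖ ≤ c * ‖x‖) (x : C) :
    ‖Φ (x * star u) - Φ x * star U‖ ≤ c * ‖x‖ := by
  have h1 := h (x * star u)
  have h2 : ‖x * star u‖ = ‖x‖ := CStarRing.norm_mul_mem_unitary x (Unitary.star_mem hu)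
  rw [mul_assoc, (Unitary.mem_iff.mp hu).1, mul_one, h2] at h1
  calc ‖Φ (x * star u) - Φ x * star U‖
      = ‖(Φ (x * star u) - Φ x * star U) * U‖ := (CStarRing.norm_mul_mem_unitary _ hU).symm
    _ = ‖Φ x - Φ (x * star u) * U‖ := by
        rw [sub_mul, mul_assoc, (Unitary.mem_iff.mp hU).1, mul_one, norm_sub_rev]
    _ ≤ _ := h1

/-- The largest modulus of the coefficients. -/
def maxCoeff (α₁ α₁' β₁ β₁' : ℂ) : ℝ := max (max ‖α₁‖ ‖α₁'‖) (max ‖β₁‖ ‖β₁'‖)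

theorem maxCoeff_nonneg (α₁ α₁' β₁ β₁' : ℂ) : 0 ≤ maxCoeff α₁ α₁' β₁ β₁' :=
  le_max_of_le_left (le_max_of_le_left (norm_nonneg _))

theorem norm_smul_add_le_maxCoeff {E : Type*} [SeminormedAddCommGroup E] [NormedSpace ℂ E]
    (α₁ α₁' β₁ β₁' : ℂ) {a b c d : E} {r : ℝ} (ha : ‖a‖ ≤ r) (hb : ‖b‖ ≤ r) (hc : ‖c‖ ≤ r)
    (hd : ‖d‖ ≤ r) :
    ‖α₁ • a + α₁' • b + β₁ • c + β₁' • d‖ ≤ 4 * maxCoeff α₁ α₁' β₁ β₁' * r := by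
  have hr : 0 ≤ r := (norm_nonneg _).trans ha
  have key : ∀ (t : ℂ) (e : E), ‖t‖ ≤ maxCoeff α₁ α₁' β₁ β₁' → ‖e‖ ≤ r →
      ‖t • e‖ ≤ maxCoeff α₁ α₁' β₁ β₁' * r := fun t e ht he => by
    have := maxCoeff_nonneg α₁ α₁' β₁ β₁'
    rw [norm_smul]; gcongr
  have h1 := key α₁ a (by simp [maxCoeff]) ha
  have h2 := key α₁' b (by simp [maxCoeff]) hb
  have h3 := key β₁ c (by simp [maxCoeff]) hc
  have h4 := key β₁' d (by simp [maxCoeff]) hd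
  have h5 := norm_add₄_le (a := α₁ • a) (b := α₁' • b) (c := β₁ • c) (d := β₁' • d)
  linarith

theorem star_hamiltonian {A : Type*} [Ring A] [StarRing A] [Algebra ℂ A] [StarModule ℂ A]
    (α₁ α₁' β₁ β₁' : ℂ) (u v : A) :
    star (hamiltonian α₁ α₁' β₁ β₁' u v) =
      hamiltonian (star α₁') (star α₁) (star β₁') (star β₁) u v := by
  simp only [hamiltonian, star_add, star_smul, star_star]
  abel

variable [Nontrivial C] [Nontrivial B] {Φ : C →ₗ[ℂ] B} {u v : C} {U V : B} {c : ℝ}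

theorem IsApproxHom.norm_map_mul_hamiltonian_sub_le (h : IsApproxHom Φ u v U V c)
    (hu : u ∈ unitary C) (hv : v ∈ unitary C) (hU : U ∈ unitary B) (hV : V ∈ unitary B)
    (α₁ α₁' β₁ β₁' : ℂ) (x : C) :
    ‖Φ (x * hamiltonian α₁ α₁' β₁ β₁' u v) - Φ x * hamiltonian α₁ α₁' β₁ β₁' U V‖ ≤
      4 * maxCoeff α₁ α₁' β₁ β₁' * (c * ‖x‖) := by
  have := norm_smul_add_le_maxCoeff α₁ α₁' β₁ β₁' (h.right_u x)
    (norm_map_mul_star_sub_le hu hU h.right_u x) (h.right_v x)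
    (norm_map_mul_star_sub_le hv hV h.right_v x)
  refine le_trans (le_of_eq ?_) this
  congr 1
  simp only [hamiltonian, mul_add, mul_smul_comm, map_add, map_smul, smul_sub]
  abel

/-- The left-handed estimate is the adjoint of the right-handed one: the adjoint of a Hamiltonian is
again a Hamiltonian, with conjugated and swapped coefficients and hence the same maximum. -/
theorem IsApproxHom.norm_map_hamiltonian_mul_sub_le (h : IsApproxHom Φ u v U V c)
    (hu : u ∈ unitary C) (hv : v ∈ unitary C) (hU : U ∈ unitary B) (hV : V ∈ unitary B)
    (α₁ α₁' β₁ β₁' : ℂ) (x : C) :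
    ‖Φ (hamiltonian α₁ α₁' β₁ β₁' u v * x) - hamiltonian α₁ α₁' β₁ β₁' U V * Φ x‖ ≤
      4 * maxCoeff α₁ α₁' β₁ β₁' * (c * ‖x‖) := by
  have := h.norm_map_mul_hamiltonian_sub_le hu hv hU hV (star α₁') (star α₁) (star β₁') (star β₁)
    (star x)
  rw [← star_hamiltonian, ← star_hamiltonian, ← star_mul, h.map_star, h.map_star, ← star_mul,
    ← star_sub, norm_star, norm_star] at this
  refine this.trans (le_of_eq ?_)
  simp [maxCoeff, max_comm]

theorem IsApproxHom.pseudospectrum_subset (h : IsApproxHom Φ u v U V c) (hc : 0 ≤ c)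
    (hu : u ∈ unitary C) (hv : v ∈ unitary C) (hU : U ∈ unitary B) (hV : V ∈ unitary B)
    (α₁ α₁' β₁ β₁' : ℂ) {δ η : ℝ} (hδ : 0 < δ)
    (hη : δ + 4 * maxCoeff α₁ α₁' β₁ β₁' * c ≤ η) :
    pseudospectrum δ (hamiltonian α₁ α₁' β₁ β₁' U V) ⊆
      pseudospectrum η (hamiltonian α₁ α₁' β₁ β₁' u v) := by
  intro z hz
  by_contra hz'
  refine absurd hz ?_
  rw [notMem_pseudospectrum_iff] at hz' ⊢
  obtain ⟨hunit, hnorm⟩ := hz'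
  set g := hamiltonian α₁ α₁' β₁ β₁' u v
  set H := hamiltonian α₁ α₁' β₁ β₁' U V
  set x := Ring.inverse (algebraMap ℂ C z - g)
  set d := 4 * maxCoeff α₁ α₁' β₁ β₁' * c
  have hd : 0 ≤ d := by have := maxCoeff_nonneg α₁ α₁' β₁ β₁'; positivity
  have hη0 : 0 < η := by linarith
  have hx1 : x * (algebraMap ℂ C z - g) = 1 := Ring.inverse_mul_cancel _ hunit
  have hx2 : (algebraMap ℂ C z - g) * x = 1 := Ring.mul_inverse_cancel _ hunit
  -- From `‖x‖ < 1/η` and `d < η`. The final bound is then `‖x‖/(1 - d‖x‖) < 1/(η - d) ≤ 1/δ`.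
  have hlt : d * ‖x‖ < 1 := by
    rw [lt_div_iff₀ hη0] at hnorm
    nlinarith [norm_nonneg x]
  have h1 : ‖1 - Φ x * (algebraMap ℂ B z - H)‖ ≤ d * ‖x‖ := by
    have e : 1 - Φ x * (algebraMap ℂ B z - H) = -(Φ (x * g) - Φ x * H) := by
      rw [← h.map_one, ← hx1, mul_sub, mul_sub, map_sub, Algebra.algebraMap_eq_smul_one,
        Algebra.algebraMap_eq_smul_one, mul_smul_comm, mul_smul_comm, mul_one, mul_one, map_smul]
      abel
    rw [e, norm_neg]
    refine (h.norm_map_mul_hamiltonian_sub_le hu hv hU hV α₁ α₁' β₁ β₁' x).trans (le_of_eq ?_)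
    simp only [d]; ring
  have h2 : ‖1 - (algebraMap ℂ B z - H) * Φ x‖ ≤ d * ‖x‖ := by
    have e : 1 - (algebraMap ℂ B z - H) * Φ x = -(Φ (g * x) - H * Φ x) := by
      rw [← h.map_one, ← hx2, sub_mul, sub_mul, map_sub, Algebra.algebraMap_eq_smul_one,
        Algebra.algebraMap_eq_smul_one, smul_mul_assoc, smul_mul_assoc, one_mul, one_mul, map_smul]
      abel
    rw [e, norm_neg]
    refine (h.norm_map_hamiltonian_mul_sub_le hu hv hU hV α₁ α₁' β₁ β₁' x).trans (le_of_eq ?_)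
    simp only [d]; ring
  obtain ⟨ha, hb⟩ := isUnit_and_norm_inverse_le (h.norm_le x) hlt h1 h2
  refine ⟨ha, hb.trans_lt ?_⟩
  rw [div_lt_div_iff₀ (by linarith) hδ]
  rw [lt_div_iff₀ hη0] at hnorm
  nlinarith [norm_nonneg x]

end ApproxHom

/-! ### A Cauchy-Schwarz inequality for matrix coefficients -/

section Gram

variable {B : Type*} [CStarAlgebra B] {ι : Type*} [Fintype ι]

theorem norm_sum_star_mul_le (X Y : ι → B) :
    ‖∑ i, star (X i) * Y i‖ ≤ √‖∑ i, star (X i) * X i‖ * √‖∑ i, star (Y i) * Y i‖ := by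
  let _ := CStarAlgebra.spectralOrder B
  have _ := CStarAlgebra.spectralOrderedRing B
  have h := CStarModule.norm_inner_le (A := B) (WithCStarModule B (ι → B))
    (x := WithCStarModule.equiv B (ι → B) |>.symm fun i => star (Y i))
    (y := WithCStarModule.equiv B (ι → B) |>.symm fun i => star (X i))
  rw [mul_comm, WithCStarModule.pi_norm, WithCStarModule.pi_norm] at h
  simpa [WithCStarModule.pi_inner, WithCStarModule.inner_def] using h

-- The hypothesis says `X^*X ≤ r²`. Writing `r² - X^*X = Q^*Q`, the gap between the two sums before
-- taking norms is `∑ (QY)_s^* (QY)_s ≥ 0`, so the scalar bound survives with entries in `B`.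
open scoped InnerProductSpace ComplexOrder MatrixOrder in
theorem norm_sum_star_mulVec_mul_le [DecidableEq ι] {X : Matrix ι ι ℂ} {r : ℝ}
    (hX : ∀ d : ι → ℂ, ∑ s, ‖∑ t, X s t * d t‖ ^ 2 ≤ r ^ 2 * ∑ t, ‖d t‖ ^ 2)
    (Y : ι → B) :
    ‖∑ s, star (∑ t, X s t • Y t) * (∑ t, X s t • Y t)‖ ≤ r ^ 2 * ‖∑ t, star (Y t) * Y t‖ := by
  let _ := CStarAlgebra.spectralOrder B
  have _ := CStarAlgebra.spectralOrderedRing B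
  have hcol : ∀ Z : Matrix ι ι ℂ, ∑ s, star (∑ t, Z s t • Y t) * (∑ t, Z s t • Y t) =
      ∑ t, ∑ t', (Z.conjTranspose * Z) t t' • (star (Y t) * Y t') := by
    intro Z
    simp only [star_sum, star_smul, Finset.sum_mul_sum, Matrix.mul_apply, Finset.sum_smul,
      Matrix.conjTranspose_apply, smul_mul_smul_comm]
    rw [Finset.sum_comm]
    refine Finset.sum_congr rfl fun t _ => ?_
    rw [Finset.sum_comm]
  set P : Matrix ι ι ℂ := ((r ^ 2 : ℝ) : ℂ) • 1 - X.conjTranspose * X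
  have hP : P.PosSemidef := by
    refine Matrix.PosSemidef.of_dotProduct_mulVec_nonneg ?_ ?_
    · simp [Matrix.IsHermitian, P]
    · intro d
      have e1 : star d ⬝ᵥ P.mulVec d =
          ((r ^ 2 * ∑ t, ‖d t‖ ^ 2 - ∑ s, ‖∑ t, X s t * d t‖ ^ 2 : ℝ) : ℂ) := by
        have e2 : ∀ w : ι → ℂ, star w ⬝ᵥ w = ((∑ t, ‖w t‖ ^ 2 : ℝ) : ℂ) := by
          intro w
          simp [dotProduct, Complex.conj_mul']
        have e3 : star d ⬝ᵥ (X.conjTranspose * X).mulVec d = star (X.mulVec d) ⬝ᵥ X.mulVec d := by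
          rw [← Matrix.mulVec_mulVec, Matrix.dotProduct_mulVec, Matrix.star_mulVec]
        simp only [P, Matrix.sub_mulVec, dotProduct_sub, e3, Matrix.smul_mulVec,
          Matrix.one_mulVec, dotProduct_smul, e2]
        simp only [Matrix.mulVec, dotProduct]
        push_cast
        simp
      rw [e1]
      exact_mod_cast sub_nonneg.mpr (hX d)
  obtain ⟨Q, hQ⟩ := CStarAlgebra.nonneg_iff_eq_star_mul_self.mp hP.nonneg
  have hsum : r ^ 2 • ∑ t, star (Y t) * Y t =
      ∑ s, star (∑ t, X s t • Y t) * (∑ t, X s t • Y t) +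
        ∑ s, star (∑ t, Q s t • Y t) * (∑ t, Q s t • Y t) := by
    rw [hcol, hcol, ← Finset.sum_add_distrib]
    simp_rw [← Finset.sum_add_distrib, ← add_smul, ← Matrix.add_apply]
    have e : X.conjTranspose * X + Q.conjTranspose * Q = ((r ^ 2 : ℝ) : ℂ) • 1 := by
      rw [← Matrix.star_eq_conjTranspose Q, ← hQ]; simp [P]
    rw [e]
    simp only [Matrix.smul_apply, Matrix.one_apply, smul_eq_mul, mul_ite, mul_one, mul_zero,
      ite_smul, zero_smul, Finset.sum_ite_eq, Finset.mem_univ, if_true, Finset.smul_sum,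
      Complex.coe_smul]
  have hle : ∑ s, star (∑ t, X s t • Y t) * (∑ t, X s t • Y t) ≤
      r ^ 2 • ∑ t, star (Y t) * Y t := by
    rw [hsum]
    exact le_add_of_nonneg_right (Finset.sum_nonneg fun _ _ => star_mul_self_nonneg _)
  have := CStarAlgebra.norm_le_norm_of_nonneg_of_le
    (Finset.sum_nonneg fun _ _ => star_mul_self_nonneg _) hle
  rwa [norm_smul, Real.norm_of_nonneg (by positivity)] at this

-- The Gram matrix is a compression of `T`, so Bessel's inequality bounds it by `‖T‖`;
-- Cauchy-Schwarz in `B^ι` does the rest.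
open scoped InnerProductSpace in
theorem norm_sum_inner_smul_le [DecidableEq ι] {K : Type*} [NormedAddCommGroup K]
    [InnerProductSpace ℂ K] {ξ : ι → K} (hξ : Orthonormal ℂ ξ) (T : K →L[ℂ] K) (X Y : ι → B)
    {a b : ℝ} (ha : 0 ≤ a) (hb : 0 ≤ b)
    (hX : ‖∑ i, star (X i) * X i‖ ≤ a ^ 2) (hY : ‖∑ i, star (Y i) * Y i‖ ≤ b ^ 2) :
    ‖∑ s, ∑ t, (⟪ξ s, T (ξ t)⟫_ℂ) • (star (X s) * Y t)‖ ≤ ‖T‖ * a * b := by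
  set G : Matrix ι ι ℂ := Matrix.of fun s t => ⟪ξ s, T (ξ t)⟫_ℂ
  have hG : ∀ d : ι → ℂ, ∑ s, ‖∑ t, G s t * d t‖ ^ 2 ≤ ‖T‖ ^ 2 * ∑ t, ‖d t‖ ^ 2 := by
    intro d
    have e : ∀ s, ∑ t, G s t * d t = ⟪ξ s, T (∑ t, d t • ξ t)⟫_ℂ := by
      intro s
      simp [G, mul_comm]
    simp_rw [e]
    refine (hξ.sum_inner_products_le _).trans ?_
    have e2 : ‖∑ t, d t • ξ t‖ ^ 2 = ∑ t, ‖d t‖ ^ 2 := by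
      rw [← inner_self_eq_norm_sq (𝕜 := ℂ), hξ.inner_sum]
      simp [Complex.conj_mul', ← Complex.ofReal_pow]
    rw [← e2, ← mul_pow]
    gcongr
    exact T.le_opNorm _
  have h1 := norm_sum_star_mulVec_mul_le hG Y
  have h2 := norm_sum_star_mul_le X fun s => ∑ t, G s t • Y t
  calc ‖∑ s, ∑ t, (⟪ξ s, T (ξ t)⟫_ℂ) • (star (X s) * Y t)‖
      = ‖∑ s, star (X s) * ∑ t, G s t • Y t‖ := by simp [G, Finset.mul_sum]
    _ ≤ √(a ^ 2) * √(‖T‖ ^ 2 * b ^ 2) := by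
        refine h2.trans ?_
        gcongr
        exact h1.trans (by gcongr)
    _ = ‖T‖ * a * b := by
        rw [← mul_pow, Real.sqrt_sq ha, Real.sqrt_sq (by positivity)]; ring

end Gram

/-! ### The window function -/

theorem sum_window_sq (N : ℝ) (m : ℕ) :
    ∑ j ∈ Finset.range m, ((j : ℝ) * (N - j)) ^ 2 =
      N ^ 2 * ((m - 1) * m * (2 * m - 1) / 6) - 2 * N * ((m * (m - 1) / 2) ^ 2) +
        (m - 1) * m * (2 * m - 1) * (3 * (m : ℝ) ^ 2 - 3 * m - 1) / 30 := by
  induction m with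
  | zero => simp
  | succ m ih => rw [Finset.sum_range_succ, ih]; push_cast; ring

theorem sum_window_diff_sq (N : ℝ) (m : ℕ) :
    ∑ j ∈ Finset.range m, (((j + 1 : ℕ) : ℝ) * (N - (j + 1 : ℕ)) - (j : ℝ) * (N - j)) ^ 2 =
      m * (N - 1) ^ 2 - 2 * (N - 1) * (m * (m - 1)) + 4 * ((m - 1) * m * (2 * m - 1) / 6) := by
  induction m with
  | zero => simp
  | succ m ih => rw [Finset.sum_range_succ, ih]; push_cast; ring

/-- The normalised parabola `j(q - j)/√S` works: its gradient energy is exactly `10/(q² + 1)`. For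
`q = 1` the boundary condition `f 0 = 0` contradicts the normalisation. -/
theorem exists_window {q : ℕ} (hq : 2 ≤ q) : ∃ f : ℕ → ℝ, f 0 = 0 ∧ f q = 0 ∧
    ∑ j : Fin q, f j ^ 2 = 1 ∧ ∑ j : Fin q, (f (j + 1) - f j) ^ 2 ≤ 10 / (q : ℝ) ^ 2 := by
  have hq' : (2 : ℝ) ≤ q := by exact_mod_cast hq
  set S : ℝ := (q : ℝ) * ((q : ℝ) ^ 4 - 1) / 30 with hS
  have hq4 : (1 : ℝ) < (q : ℝ) ^ 4 := one_lt_pow₀ (by linarith) (by norm_num)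
  have hSpos : 0 < S := by
    have : (0 : ℝ) < (q : ℝ) ^ 4 - 1 := by linarith
    positivity
  have e1 : ∑ j ∈ Finset.range q, ((j : ℝ) * (q - j)) ^ 2 = S := by
    rw [sum_window_sq, hS]; ring
  have e2 : ∑ j ∈ Finset.range q,
      (((j + 1 : ℕ) : ℝ) * (q - (j + 1 : ℕ)) - (j : ℝ) * (q - j)) ^ 2 =
        (q : ℝ) * ((q : ℝ) ^ 2 - 1) / 3 := by
    rw [sum_window_diff_sq]; ring
  refine ⟨fun j => (j : ℝ) * (q - j) / √S, by simp, by simp, ?_, ?_⟩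
  · rw [Fin.sum_univ_eq_sum_range (fun j => ((j : ℝ) * (q - j) / √S) ^ 2)]
    simp_rw [div_pow, Real.sq_sqrt hSpos.le]
    rw [← Finset.sum_div, e1, div_self hSpos.ne']
  · rw [Fin.sum_univ_eq_sum_range (fun j =>
      (((j + 1 : ℕ) : ℝ) * (q - (j + 1 : ℕ)) / √S - (j : ℝ) * (q - j) / √S) ^ 2)]
    simp_rw [← sub_div, div_pow, Real.sq_sqrt hSpos.le]
    rw [← Finset.sum_div, e2, div_le_div_iff₀ hSpos (by positivity), hS]
    nlinarith

/-! ### The compression map of a window -/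

section Window

open scoped InnerProductSpace

variable {C B K : Type*} [CStarAlgebra C] [CStarAlgebra B] [NormedAddCommGroup K]
  [InnerProductSpace ℂ K] [CompleteSpace K]

/-- The map `x ↦ ∑ ⟨ξ_s, π(x) ξ_t⟩ J_s^* J_t`, the sum being over `s, t ∈ [0,q)²`. -/
def windowMap (q : ℕ) (π : C →⋆ₐ[ℂ] (K →L[ℂ] K)) (ξ : ℕ → ℕ → K) (J : ℕ → ℕ → B) :
    C →ₗ[ℂ] B where
  toFun x := ∑ s : Fin q × Fin q, ∑ t : Fin q × Fin q,
    (⟪ξ s.1 s.2, π x (ξ t.1 t.2)⟫_ℂ) • (star (J s.1 s.2) * J t.1 t.2)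
  map_add' x y := by
    simp only [map_add, add_apply, inner_add_right, add_smul,
      Finset.sum_add_distrib]
  map_smul' c x := by
    simp only [map_smul, smul_apply, inner_smul_right, mul_smul,
      Finset.smul_sum, RingHom.id_apply]

theorem windowMap_apply (q : ℕ) (π : C →⋆ₐ[ℂ] (K →L[ℂ] K)) (ξ : ℕ → ℕ → K) (J : ℕ → ℕ → B)
    (x : C) : windowMap q π ξ J x = ∑ s : Fin q × Fin q, ∑ t : Fin q × Fin q,
      (⟪ξ s.1 s.2, π x (ξ t.1 t.2)⟫_ℂ) • (star (J s.1 s.2) * J t.1 t.2) := rfl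

theorem windowMap_star (q : ℕ) (π : C →⋆ₐ[ℂ] (K →L[ℂ] K)) (ξ : ℕ → ℕ → K) (J : ℕ → ℕ → B)
    (x : C) : windowMap q π ξ J (star x) = star (windowMap q π ξ J x) := by
  simp only [windowMap_apply, star_sum, star_smul, star_mul, star_star]
  rw [Finset.sum_comm]
  refine Finset.sum_congr rfl fun s _ => Finset.sum_congr rfl fun t _ => ?_
  rw [map_star, ContinuousLinearMap.star_eq_adjoint, ContinuousLinearMap.adjoint_inner_right,
    ← inner_conj_symm]
  rfl

theorem sum_star_mul_smul_unitary {ι : Type*} [Fintype ι] (c : ι → ℂ) {W : ι → B}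
    (hW : ∀ i, W i ∈ unitary B) :
    ∑ i, star (c i • W i) * (c i • W i) = ((∑ i, ‖c i‖ ^ 2 : ℝ) : ℂ) • (1 : B) := by
  push_cast
  rw [Finset.sum_smul]
  refine Finset.sum_congr rfl fun i _ => ?_
  rw [star_smul, smul_mul_smul_comm, (Unitary.mem_iff.mp (hW i)).1]
  simp [Complex.conj_mul']

theorem norm_sum_star_mul_smul_unitary_le {ι : Type*} [Fintype ι] {c : ι → ℂ} {W : ι → B}
    (hW : ∀ i, W i ∈ unitary B) {r : ℝ} (hc : ∑ i, ‖c i‖ ^ 2 ≤ r) :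
    ‖∑ i, star (c i • W i) * (c i • W i)‖ ≤ r := by
  have h0 : 0 ≤ ∑ i, ‖c i‖ ^ 2 := Finset.sum_nonneg fun _ _ => by positivity
  rw [sum_star_mul_smul_unitary c hW, norm_smul, Complex.norm_real, Real.norm_of_nonneg h0]
  have h1 : ‖(1 : B)‖ ≤ 1 := by
    cases subsingleton_or_nontrivial B
    · simp [Subsingleton.elim (1 : B) 0]
    · simp
  nlinarith [norm_nonneg (1 : B)]

/-- This is where the vanishing of the window at `0` and `q` is used: the index shift leaves no
boundary terms. -/
theorem sum_fin_eq_sum_succ {E : Type*} [AddCommMonoid E] {q : ℕ} {G : ℕ → E} (h0 : G 0 = 0)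
    (hq : G q = 0) : ∑ j : Fin q, G j = ∑ j : Fin q, G (j + 1) := by
  rw [Fin.sum_univ_eq_sum_range G, Fin.sum_univ_eq_sum_range fun j => G (j + 1)]
  have := (Finset.sum_range_succ G q).symm.trans (Finset.sum_range_succ' G q)
  simpa [h0, hq] using this

theorem commute_pow_mul {A : Type*} [Ring A] [Algebra ℂ A] {U V : A} {ζ : ℂ}
    (h : U * V = ζ • (V * U)) (j : ℕ) : U ^ j * V = ζ ^ j • (V * U ^ j) := by
  induction j with
  | zero => simp
  | succ j ih =>
    rw [pow_succ', mul_assoc, ih, mul_smul_comm, ← mul_assoc, h, smul_mul_assoc, smul_smul,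
      mul_assoc, ← pow_succ]

variable {q : ℕ} {π : C →⋆ₐ[ℂ] (K →L[ℂ] K)} {ξ : ℕ → ℕ → K} {u v : C} {U V : B} {ζ' ζ : ℂ}
  {f : ℕ → ℝ}

/-- The right-hand window may be any weighted family of unitaries. Weights of `ℓ²` norm `1` give
contractivity of `Φ`; small weights give the multiplicativity defects. -/
theorem norm_windowSum_le (hξ : Orthonormal ℂ fun s : Fin q × Fin q => ξ s.1 s.2)
    (hU : U ∈ unitary B) (hV : V ∈ unitary B) (hf : ∑ j : Fin q, f j ^ 2 = 1) (x : C)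
    {c : Fin q × Fin q → ℂ} {W : Fin q × Fin q → B} (hW : ∀ i, W i ∈ unitary B) {r : ℝ}
    (hr : 0 ≤ r) (hc : ∑ i, ‖c i‖ ^ 2 ≤ r ^ 2) :
    ‖∑ s : Fin q × Fin q, ∑ t : Fin q × Fin q, (⟪ξ s.1 s.2, π x (ξ t.1 t.2)⟫_ℂ) •
      (star (((f s.1 * f s.2 : ℝ) : ℂ) • (V ^ (s.2 : ℕ) * U ^ (s.1 : ℕ))) * (c t • W t))‖ ≤
      r * ‖x‖ := by
  have hfs : ∑ i : Fin q × Fin q, ‖((f i.1 * f i.2 : ℝ) : ℂ)‖ ^ 2 ≤ 1 ^ 2 := by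
    simp only [Complex.norm_real, Real.norm_eq_abs, sq_abs, mul_pow]
    rw [Fintype.sum_prod_type]
    dsimp only
    rw [← Finset.sum_mul_sum, hf]
    norm_num
  have h := norm_sum_inner_smul_le hξ (π x) _ _ zero_le_one hr
    (norm_sum_star_mul_smul_unitary_le
      (W := fun s : Fin q × Fin q => V ^ (s.2 : ℕ) * U ^ (s.1 : ℕ))
      (fun s => mul_mem (pow_mem hV _) (pow_mem hU _)) hfs)
    (norm_sum_star_mul_smul_unitary_le hW hc)
  refine h.trans ?_
  have := NonUnitalStarAlgHom.norm_apply_le π x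
  nlinarith

theorem exists_isApproxHom [Nontrivial C] [Nontrivial B] (hq : 1 ≤ q)
    (hu : u ∈ unitary C) (hv : v ∈ unitary C) (hU : U ∈ unitary B) (hV : V ∈ unitary B)
    (hUV : U * V = ζ • (V * U)) (hζ' : ‖ζ'‖ = 1)
    (hclose : ∀ j < q, ‖ζ' ^ j - ζ ^ j‖ ≤ 7 / q)
    (hξu : ∀ j k, π u (ξ (j + 1) k) = ξ j k) (hξv : ∀ j k, π v (ξ j (k + 1)) = ζ' ^ j • ξ j k)
    (hξ : Orthonormal ℂ fun s : Fin q × Fin q => ξ s.1 s.2) :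
    ∃ Φ : C →ₗ[ℂ] B, IsApproxHom Φ u v U V (11 / q) := by
  have hone : ∀ f : ℕ → ℝ, ∑ j : Fin q, f j ^ 2 = 1 →
      windowMap q π ξ (fun j k => ((f j * f k : ℝ) : ℂ) • (V ^ k * U ^ j)) 1 = 1 := by
    intro f hf
    rw [windowMap_apply]
    simp only [map_one, one_apply_eq_self, orthonormal_iff_ite.mp hξ, ite_smul,
      one_smul, zero_smul, Finset.sum_ite_eq, Finset.mem_univ, if_true]
    rw [sum_star_mul_smul_unitary (fun s : Fin q × Fin q => ((f s.1 * f s.2 : ℝ) : ℂ))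
      (W := fun s : Fin q × Fin q => V ^ (s.2 : ℕ) * U ^ (s.1 : ℕ))
      (fun s => mul_mem (pow_mem hV _) (pow_mem hU _))]
    simp only [Complex.norm_real, Real.norm_eq_abs, sq_abs, mul_pow]
    rw [Fintype.sum_prod_type]
    dsimp only
    rw [← Finset.sum_mul_sum, hf]
    simp
  have hle : ∀ f : ℕ → ℝ, ∑ j : Fin q, f j ^ 2 = 1 → ∀ x,
      ‖windowMap q π ξ (fun j k => ((f j * f k : ℝ) : ℂ) • (V ^ k * U ^ j)) x‖ ≤ ‖x‖ := by
    intro f hf x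
    have := norm_windowSum_le (π := π) hξ hU hV hf x
      (c := fun s => ((f s.1 * f s.2 : ℝ) : ℂ))
      (W := fun s : Fin q × Fin q => V ^ (s.2 : ℕ) * U ^ (s.1 : ℕ))
      (fun s => mul_mem (pow_mem hV _) (pow_mem hU _)) zero_le_one (by
        simp only [Complex.norm_real, Real.norm_eq_abs, sq_abs, mul_pow]
        rw [Fintype.sum_prod_type]
        dsimp only
        rw [← Finset.sum_mul_sum, hf]
        norm_num)
    simpa [windowMap_apply] using this
  -- For `q = 1` there is no vanishing window, but contractivity alone bounds the defect by `2‖x‖ ≤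
  -- 11‖x‖`.
  obtain rfl | hq2 : q = 1 ∨ 2 ≤ q := by omega
  · obtain ⟨f, hf⟩ : ∃ f : ℕ → ℝ, ∑ j : Fin 1, f j ^ 2 = 1 := ⟨fun _ => 1, by simp⟩
    set Φ := windowMap 1 π ξ fun j k => ((f j * f k : ℝ) : ℂ) • (V ^ k * U ^ j)
    have crude : ∀ {w : C} {W : B}, w ∈ unitary C → W ∈ unitary B → ∀ x,
        ‖Φ (x * w) - Φ x * W‖ ≤ 11 / (1 : ℕ) * ‖x‖ := by
      intro w W hw hW x
      have h1 := hle f hf (x * w)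
      have h2 := hle f hf x
      rw [CStarRing.norm_mul_mem_unitary x hw] at h1
      refine (norm_sub_le _ _).trans ?_
      rw [CStarRing.norm_mul_mem_unitary _ hW]
      have := norm_nonneg x
      push_cast
      linarith
    exact ⟨Φ, hone f hf, windowMap_star _ _ _ _, hle f hf, crude hu hU, crude hv hV⟩
  obtain ⟨f, hf0, hfq, hf, hfd⟩ := exists_window hq2
  have hq0 : (0 : ℝ) < q := by positivity
  refine ⟨_, hone f hf, windowMap_star _ _ _ _, hle f hf, fun x => ?_, fun x => ?_⟩
  -- Shifting `j` turns `Φ(xu) - Φ(x)U` into a window sum with weights `(f(j+1) - f(j)) f(k)`, of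
  -- squared norm at most `10/q²`.
  · have key := norm_windowSum_le (π := π) hξ hU hV hf x
      (c := fun s => (((f (s.1 + 1) - f s.1) * f s.2 : ℝ) : ℂ))
      (W := fun s : Fin q × Fin q => V ^ (s.2 : ℕ) * U ^ ((s.1 : ℕ) + 1))
      (fun s => mul_mem (pow_mem hV _) (pow_mem hU _)) (r := 11 / q) (by positivity) (by
        simp only [Complex.norm_real, Real.norm_eq_abs, sq_abs, mul_pow]
        rw [Fintype.sum_prod_type]
        dsimp only
        rw [← Finset.sum_mul_sum, hf, mul_one, div_pow]
        exact hfd.trans (by gcongr; norm_num))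
    refine le_trans (le_of_eq ?_) key
    congr 1
    rw [windowMap_apply, windowMap_apply, Finset.sum_mul, ← Finset.sum_sub_distrib]
    refine Finset.sum_congr rfl fun s _ => ?_
    rw [Fintype.sum_prod_type_right, Fintype.sum_prod_type_right, Fintype.sum_prod_type_right,
      Finset.sum_mul, ← Finset.sum_sub_distrib]
    refine Finset.sum_congr rfl fun k _ => ?_
    dsimp only
    rw [sum_fin_eq_sum_succ (q := q) (G := fun j : ℕ => (⟪ξ s.1 s.2, π (x * u) (ξ j k)⟫_ℂ) •
      (star (((f s.1 * f s.2 : ℝ) : ℂ) • (V ^ (s.2 : ℕ) * U ^ (s.1 : ℕ))) *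
        (((f j * f k : ℝ) : ℂ) • (V ^ (k : ℕ) * U ^ j)))) (by simp [hf0]) (by simp [hfq]),
      Finset.sum_mul, ← Finset.sum_sub_distrib]
    refine Finset.sum_congr rfl fun j _ => ?_
    rw [map_mul, mul_apply_eq_comp, hξu, smul_mul_assoc, ← smul_sub, mul_assoc,
      ← mul_sub, smul_mul_assoc, mul_assoc, ← pow_succ, ← sub_smul, ← Complex.ofReal_sub,
      ← sub_mul]
  · have key := norm_windowSum_le (π := π) hξ hU hV hf x
      (c := fun s => (f s.1 : ℂ) * (ζ' ^ (s.1 : ℕ) * f (s.2 + 1) - f s.2 * ζ ^ (s.1 : ℕ)))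
      (W := fun s : Fin q × Fin q => V ^ ((s.2 : ℕ) + 1) * U ^ (s.1 : ℕ))
      (fun s => mul_mem (pow_mem hV _) (pow_mem hU _)) (r := 11 / q) (by positivity) (by
        have hb : ∀ s : Fin q × Fin q, ‖(f s.1 : ℂ) * (ζ' ^ (s.1 : ℕ) * f (s.2 + 1) -
            f s.2 * ζ ^ (s.1 : ℕ))‖ ^ 2 ≤
              f s.1 ^ 2 * (2 * (f (s.2 + 1) - f s.2) ^ 2 + 2 * (7 / q) ^ 2 * f s.2 ^ 2) := by
          intro s
          rw [norm_mul, mul_pow, Complex.norm_real, Real.norm_eq_abs, sq_abs]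
          gcongr
          -- Split the weight into a window gradient and a phase mismatch; the phases come from
          -- `π(v)ξ_{j,k+1} = ζ'^j ξ_{jk}` and `U^j V = ζ^j V U^j`.
          have e : ζ' ^ (s.1 : ℕ) * f (s.2 + 1) - f s.2 * ζ ^ (s.1 : ℕ) =
              ζ' ^ (s.1 : ℕ) * ((f (s.2 + 1) - f s.2 : ℝ) : ℂ) +
                f s.2 * (ζ' ^ (s.1 : ℕ) - ζ ^ (s.1 : ℕ)) := by push_cast; ring
          have h1 : ‖ζ' ^ (s.1 : ℕ) * f (s.2 + 1) - f s.2 * ζ ^ (s.1 : ℕ)‖ ≤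
              |f (s.2 + 1) - f s.2| + |f s.2| * (7 / q) := by
            rw [e]
            refine (norm_add_le _ _).trans ?_
            rw [norm_mul, norm_mul, norm_pow, hζ', one_pow, one_mul, Complex.norm_real,
              Complex.norm_real, Real.norm_eq_abs, Real.norm_eq_abs]
            gcongr
            exact hclose _ s.1.isLt
          calc _ ≤ (|f (s.2 + 1) - f s.2| + |f s.2| * (7 / q)) ^ 2 := by gcongr
            _ ≤ 2 * |f (s.2 + 1) - f s.2| ^ 2 + 2 * (|f s.2| * (7 / q)) ^ 2 := by
              nlinarith [sq_nonneg (|f (s.2 + 1) - f s.2| - |f s.2| * (7 / q))]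
            _ = _ := by rw [mul_pow, sq_abs, sq_abs]; ring
        refine (Finset.sum_le_sum fun s _ => hb s).trans ?_
        rw [Fintype.sum_prod_type]
        dsimp only
        rw [← Finset.sum_mul_sum, hf, one_mul, Finset.sum_add_distrib,
          ← Finset.mul_sum, ← Finset.mul_sum, hf, mul_one]
        -- Origin of the constant `11`: `2·10 + 2·49 = 118 = 11² - 3`.
        have e : (11 / (q : ℝ)) ^ 2 = 2 * (10 / (q : ℝ) ^ 2) + 2 * (7 / (q : ℝ)) ^ 2 +
            3 / (q : ℝ) ^ 2 := by field_simp; norm_num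
        have : 0 ≤ 3 / (q : ℝ) ^ 2 := by positivity
        linarith)
    refine le_trans (le_of_eq ?_) key
    congr 1
    rw [windowMap_apply, windowMap_apply, Finset.sum_mul, ← Finset.sum_sub_distrib]
    refine Finset.sum_congr rfl fun s _ => ?_
    rw [Fintype.sum_prod_type, Fintype.sum_prod_type, Fintype.sum_prod_type,
      Finset.sum_mul, ← Finset.sum_sub_distrib]
    refine Finset.sum_congr rfl fun j _ => ?_
    dsimp only
    rw [sum_fin_eq_sum_succ (q := q) (G := fun k : ℕ => (⟪ξ s.1 s.2, π (x * v) (ξ j k)⟫_ℂ) •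
      (star (((f s.1 * f s.2 : ℝ) : ℂ) • (V ^ (s.2 : ℕ) * U ^ (s.1 : ℕ))) *
        (((f j * f k : ℝ) : ℂ) • (V ^ k * U ^ (j : ℕ))))) (by simp [hf0]) (by simp [hfq]),
      Finset.sum_mul, ← Finset.sum_sub_distrib]
    refine Finset.sum_congr rfl fun k _ => ?_
    rw [map_mul, mul_apply_eq_comp, hξv, map_smul, inner_smul_right, mul_comm, mul_smul,
      smul_mul_assoc, ← smul_sub, mul_assoc (star _), ← mul_smul_comm, ← mul_sub, smul_mul_assoc,
      mul_assoc (V ^ (k : ℕ)), commute_pow_mul hUV, mul_smul_comm, ← mul_assoc, ← pow_succ,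
      smul_smul, smul_smul, ← sub_smul]
    congr 3
    push_cast
    ring

end Window

/-! ### The matrix pair -/

/-- The root of unity `e^{2πit}`. -/
def expRot (t : ℝ) : ℂ := Complex.exp (2 * (Real.pi : ℂ) * Complex.I * (t : ℂ))

theorem expRot_eq (t : ℝ) : expRot t = Complex.exp ((2 * Real.pi * t : ℝ) * Complex.I) := by
  rw [expRot]; congr 1; push_cast; ring

theorem norm_expRot (t : ℝ) : ‖expRot t‖ = 1 := by
  rw [expRot_eq, Complex.norm_exp_ofReal_mul_I]

theorem norm_expRot_pow_sub_le (s t : ℝ) (j : ℕ) :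
    ‖expRot s ^ j - expRot t ^ j‖ ≤ 2 * Real.pi * j * |s - t| := by
  have e : ∀ r : ℝ, expRot r ^ j = Complex.exp (Complex.I * ((2 * Real.pi * j * r : ℝ) : ℂ)) := by
    intro r
    rw [expRot, ← Complex.exp_nat_mul]; congr 1; push_cast; ring
  have h1 : expRot s ^ j - expRot t ^ j =
      expRot t ^ j * (Complex.exp (Complex.I * ((2 * Real.pi * j * (s - t) : ℝ) : ℂ)) - 1) := by
    rw [e, e, mul_sub, ← Complex.exp_add, mul_one]
    congr 2; push_cast; ring
  rw [h1, norm_mul, norm_pow, norm_expRot, one_pow, one_mul]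
  refine (Real.norm_exp_I_mul_ofReal_sub_one_le).trans (le_of_eq ?_)
  rw [Real.norm_eq_abs, abs_mul, abs_of_nonneg (by positivity : (0 : ℝ) ≤ 2 * Real.pi * j)]

theorem matV_eq (p q : ℕ) :
    matV p q = Matrix.diagonal fun j : Fin q => expRot ((p : ℝ) / q) ^ j.val := by
  simp [matV, expRot]

theorem matU_mem_unitary (q : ℕ) : matU q ∈ unitary (Matrix (Fin q) (Fin q) ℂ) := by
  have h : matU q * star (matU q) = 1 := by
    ext i j
    have hq : 0 < q := i.pos
    rw [Matrix.mul_apply, Finset.sum_eq_single (⟨(i.val + 1) % q, Nat.mod_lt _ hq⟩ : Fin q)]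
    · by_cases hij : i = j
      · subst hij; simp [matU, Matrix.star_apply]
      · have : ¬ (j.val + 1) % q = (i.val + 1) % q := by
          intro h
          have h2 : j.val ≡ i.val [MOD q] := Nat.ModEq.add_right_cancel' 1 h
          exact hij (Fin.ext (Nat.ModEq.eq_of_lt_of_lt h2 j.isLt i.isLt).symm)
        simp [matU, Matrix.star_apply, this, hij]
    · intro k _ hk
      have : ¬ (i.val + 1) % q = k.val := fun h => hk (Fin.ext h.symm)
      simp [matU, this]
    · simp
  exact Unitary.mem_iff.mpr ⟨mul_eq_one_comm.mp h, h⟩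

theorem matV_mem_unitary (p q : ℕ) : matV p q ∈ unitary (Matrix (Fin q) (Fin q) ℂ) := by
  have h : matV p q * star (matV p q) = 1 := by
    rw [matV_eq, Matrix.star_eq_conjTranspose, Matrix.diagonal_conjTranspose,
      Matrix.diagonal_mul_diagonal, ← Matrix.diagonal_one]
    congr 1
    funext j
    rw [Pi.star_apply, Complex.star_def, Complex.mul_conj', norm_pow, norm_expRot]
    simp
  exact Unitary.mem_iff.mpr ⟨mul_eq_one_comm.mp h, h⟩

theorem expRot_div_pow_self {p q : ℕ} (hq : q ≠ 0) : expRot ((p : ℝ) / q) ^ q = 1 := by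
  have hq' : (q : ℂ) ≠ 0 := by exact_mod_cast hq
  rw [expRot, ← Complex.exp_nat_mul]
  rw [Complex.exp_eq_one_iff]
  exact ⟨p, by push_cast; field_simp⟩

theorem matU_mul_matV (p q : ℕ) :
    matU q * matV p q = expRot ((p : ℝ) / q) • (matV p q * matU q) := by
  ext i j
  have hq : q ≠ 0 := i.pos.ne'
  rw [matV_eq, Matrix.smul_apply, Matrix.mul_diagonal, Matrix.diagonal_mul]
  by_cases h : (i.val + 1) % q = j.val
  · have h2 : expRot ((p : ℝ) / q) ^ j.val = expRot ((p : ℝ) / q) ^ (i.val + 1) := by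
      rw [← h, ← pow_eq_pow_mod _ (expRot_div_pow_self hq)]
    simp [matU, h, h2, pow_succ']
  · simp [matU, h]

/-- `x ↦ x ⊗ 1`. -/
def kroneckerOne (q : ℕ) :
    Matrix (Fin q) (Fin q) ℂ →⋆ₐ[ℂ] Matrix (Fin q × Fin q) (Fin q × Fin q) ℂ where
  toFun x := Matrix.kronecker x (1 : Matrix (Fin q) (Fin q) ℂ)
  map_one' := Matrix.one_kronecker_one
  map_mul' x y := by
    have := Matrix.mul_kronecker_mul x y (1 : Matrix (Fin q) (Fin q) ℂ)
      (1 : Matrix (Fin q) (Fin q) ℂ)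
    rwa [mul_one] at this
  map_zero' := Matrix.zero_kronecker _
  map_add' x y := Matrix.add_kronecker _ _ _
  commutes' r := by
    rw [Algebra.algebraMap_eq_smul_one, Algebra.algebraMap_eq_smul_one]
    exact (Matrix.smul_kronecker _ _ _).trans (by rw [Matrix.one_kronecker_one])
  map_star' x := by
    rw [Matrix.star_eq_conjTranspose, Matrix.star_eq_conjTranspose]
    have := Matrix.conjTranspose_kronecker x (1 : Matrix (Fin q) (Fin q) ℂ)
    rw [Matrix.conjTranspose_one] at this
    exact this.symm

/-- The representation of the `q × q` matrices on the Hilbert-Schmidt space. -/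
def hilbertSchmidtRep (q : ℕ) : Matrix (Fin q) (Fin q) ℂ →⋆ₐ[ℂ]
    (EuclideanSpace ℂ (Fin q × Fin q) →L[ℂ] EuclideanSpace ℂ (Fin q × Fin q)) :=
  (Matrix.toEuclideanCLM (n := Fin q × Fin q) (𝕜 := ℂ) : _ →⋆ₐ[ℂ] _).comp (kroneckerOne q)

/-- A matrix as a vector of the Hilbert-Schmidt space. -/
def vecHS {q : ℕ} (W : Matrix (Fin q) (Fin q) ℂ) : EuclideanSpace ℂ (Fin q × Fin q) :=
  WithLp.toLp 2 fun i => W i.1 i.2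

theorem hilbertSchmidtRep_vecHS {q : ℕ} (x W : Matrix (Fin q) (Fin q) ℂ) :
    hilbertSchmidtRep q x (vecHS W) = vecHS (x * W) := by
  change WithLp.toLp 2 ((kroneckerOne q x).mulVec fun i => W i.1 i.2) = _
  congr 1
  funext i
  simp [kroneckerOne, Matrix.mulVec, dotProduct, Matrix.mul_apply, Fintype.sum_prod_type,
    Matrix.kronecker, Matrix.kroneckerMap_apply, Matrix.one_apply]

open scoped InnerProductSpace in
theorem inner_vecHS {q : ℕ} (W Z : Matrix (Fin q) (Fin q) ℂ) :
    ⟪vecHS W, vecHS Z⟫_ℂ = (star W * Z).trace := by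
  simp only [vecHS, PiLp.inner_apply, Matrix.trace, Matrix.diag, Matrix.mul_apply,
    Matrix.star_apply, Fintype.sum_prod_type_right]
  simp [mul_comm]

theorem vecHS_smul {q : ℕ} (c : ℂ) (W : Matrix (Fin q) (Fin q) ℂ) :
    vecHS (c • W) = c • vecHS W := rfl

theorem trace_eq_zero_of_mul_eq_smul {q : ℕ} {w A : Matrix (Fin q) (Fin q) ℂ} {c : ℂ}
    (hw : w ∈ unitary (Matrix (Fin q) (Fin q) ℂ)) (h : A * w = c • (w * A)) (hc : c ≠ 1) :
    A.trace = 0 := by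
  have h1 : (star w * (A * w)).trace = A.trace := by
    rw [← mul_assoc, Matrix.trace_mul_comm, ← mul_assoc, (Unitary.mem_iff.mp hw).2, one_mul]
  rw [h, mul_smul_comm, ← mul_assoc, (Unitary.mem_iff.mp hw).1, one_mul, Matrix.trace_smul,
    smul_eq_mul] at h1
  have : (c - 1) * A.trace = 0 := by rw [sub_mul, h1]; ring
  exact (mul_eq_zero.mp this).resolve_left (sub_ne_zero.mpr hc)

/-- The orthonormal family of Weyl matrices. -/
def weylVec (p q : ℕ) (j k : ℕ) : EuclideanSpace ℂ (Fin q × Fin q) :=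
  ((√(q : ℝ) : ℝ) : ℂ)⁻¹ • vecHS (star (matU q) ^ j * star (matV p q) ^ k)

section Commutation

theorem mul_eq_inv_smul_of_comm {A : Type*} [Ring A] [Algebra ℂ A] {x y : A} {ζ : ℂ} (hζ : ζ ≠ 0)
    (h : x * y = ζ • (y * x)) : y * x = ζ⁻¹ • (x * y) := by
  rw [h, smul_smul, inv_mul_cancel₀ hζ, one_smul]

variable {A : Type*} [Ring A] [StarRing A] [Algebra ℂ A] {u v : A} {ζ : ℂ}

theorem mul_star_eq_of_comm (hu : u ∈ unitary A) (h : u * v = ζ • (v * u)) :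
    v * star u = ζ • (star u * v) := by
  have h1 := congrArg (fun x => star u * x * star u) h
  simp only [mul_smul_comm, smul_mul_assoc] at h1
  rwa [← mul_assoc, (Unitary.mem_iff.mp hu).1, one_mul, ← mul_assoc, mul_assoc _ u,
    (Unitary.mem_iff.mp hu).2, mul_one] at h1

theorem star_mul_eq_of_comm (hv : v ∈ unitary A) (h : u * v = ζ • (v * u)) :
    star v * u = ζ • (u * star v) := by
  have h1 := congrArg (fun x => star v * x * star v) h
  simp only [mul_smul_comm, smul_mul_assoc] at h1
  rwa [← mul_assoc (star v) v u, (Unitary.mem_iff.mp hv).1, one_mul, mul_assoc (star v),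
    mul_assoc u, (Unitary.mem_iff.mp hv).2, mul_one] at h1

end Commutation

theorem expRot_ne_zero (t : ℝ) : expRot t ≠ 0 := by
  rw [expRot]; exact Complex.exp_ne_zero _

/-- Moving `v` or `u` past the product of two distinct Weyl matrices produces a factor `ζ^(b-a)`
with `a ≠ b` in `[0,q)`. Coprimality makes `ζ` a primitive root, so this factor is not `1` and the
trace vanishes. -/
theorem orthonormal_weylVec {p q : ℕ} (hq : 1 ≤ q) (hpq : p.Coprime q) :
    Orthonormal ℂ fun s : Fin q × Fin q => weylVec p q s.1 s.2 := by
  set u := matU q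
  set v := matV p q
  set ζ := expRot ((p : ℝ) / q) with hζdef
  have hu : u ∈ unitary _ := matU_mem_unitary q
  have hv : v ∈ unitary _ := matV_mem_unitary p q
  have huv : u * v = ζ • (v * u) := matU_mul_matV p q
  have hζ0 : ζ ≠ 0 := expRot_ne_zero _
  have hprim : IsPrimitiveRoot ζ q := by
    have := Complex.isPrimitiveRoot_exp_of_coprime p q (by omega) hpq
    simpa [hζdef, expRot] using this
  have hq0 : (0 : ℝ) < q := by exact_mod_cast hq
  have hin : ∀ j k j' k' : ℕ, inner ℂ (weylVec p q j k) (weylVec p q j' k') =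
      (q : ℂ)⁻¹ * (v ^ k * u ^ j * (star u ^ j' * star v ^ k')).trace := by
    intro j k j' k'
    rw [weylVec, weylVec, inner_smul_left, inner_smul_right, inner_vecHS, ← mul_assoc]
    congr 1
    · rw [map_inv₀, Complex.conj_ofReal, ← mul_inv, ← Complex.ofReal_mul,
        Real.mul_self_sqrt hq0.le]
      simp
    · rw [star_mul, star_pow, star_pow, star_star, star_star]
  rw [orthonormal_iff_ite]
  rintro ⟨j, k⟩ ⟨j', k'⟩
  rw [hin]
  have hne : ∀ {a b : Fin q}, a ≠ b → (ζ⁻¹) ^ (a : ℕ) * ζ ^ (b : ℕ) ≠ 1 := by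
    intro a b hab h
    rw [inv_pow, inv_mul_eq_one₀ (pow_ne_zero _ hζ0)] at h
    exact hab (Fin.ext (hprim.pow_inj a.isLt b.isLt h))
  split_ifs with h
  · obtain ⟨rfl, rfl⟩ := Prod.mk.inj h
    have e : v ^ (k : ℕ) * u ^ (j : ℕ) * (star u ^ (j : ℕ) * star v ^ (k : ℕ)) = 1 := by
      have h1 := (Unitary.mem_iff.mp (mul_mem (pow_mem hv (k : ℕ)) (pow_mem hu (j : ℕ)))).2
      rwa [star_mul, star_pow, star_pow] at h1
    rw [e, Matrix.trace_one, Fintype.card_fin, inv_mul_cancel₀ (by exact_mod_cast hq0.ne')]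
  · have hor : j ≠ j' ∨ k ≠ k' := by
      by_contra hcon
      push Not at hcon
      exact h (Prod.ext hcon.1 hcon.2)
    have hz : (v ^ (k : ℕ) * u ^ (j : ℕ) * (star u ^ (j' : ℕ) * star v ^ (k' : ℕ))).trace = 0 := by
      rcases hor with hj | hk
      · have c1 := commute_pow_mul (mul_eq_inv_smul_of_comm hζ0 (mul_star_eq_of_comm hu huv))
          (j' : ℕ)
        have c2 := commute_pow_mul huv (j : ℕ)
        refine trace_eq_zero_of_mul_eq_smul hv (c := (ζ⁻¹) ^ (j' : ℕ) * ζ ^ (j : ℕ)) ?_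
          (hne hj.symm)
        have c3 : Commute (star v ^ (k' : ℕ)) v :=
          Commute.pow_left (show star v * v = v * star v by
            rw [(Unitary.mem_iff.mp hv).1, (Unitary.mem_iff.mp hv).2]) _
        calc v ^ (k : ℕ) * u ^ (j : ℕ) * (star u ^ (j' : ℕ) * star v ^ (k' : ℕ)) * v
            = v ^ (k : ℕ) * u ^ (j : ℕ) * ((star u ^ (j' : ℕ) * v) * star v ^ (k' : ℕ)) := by
              rw [mul_assoc, mul_assoc (star u ^ _), c3.eq, ← mul_assoc (star u ^ _)]
          _ = (ζ⁻¹) ^ (j' : ℕ) • (v ^ (k : ℕ) * (u ^ (j : ℕ) * v) *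
              (star u ^ (j' : ℕ) * star v ^ (k' : ℕ))) := by
              rw [c1, smul_mul_assoc, mul_smul_comm]; simp only [mul_assoc]
          _ = _ := by
              rw [c2, mul_smul_comm, smul_mul_assoc, smul_smul, ← mul_assoc (v ^ (k : ℕ)) v,
                ← pow_succ, pow_succ']
              simp only [mul_assoc]
      · have c1 := commute_pow_mul (star_mul_eq_of_comm hv huv) (k' : ℕ)
        have c2 := commute_pow_mul (mul_eq_inv_smul_of_comm hζ0 huv) (k : ℕ)
        refine trace_eq_zero_of_mul_eq_smul hu (c := (ζ⁻¹) ^ (k : ℕ) * ζ ^ (k' : ℕ)) ?_ (hne hk)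
        have c3 : Commute (star u ^ (j' : ℕ)) u :=
          Commute.pow_left (show star u * u = u * star u by
            rw [(Unitary.mem_iff.mp hu).1, (Unitary.mem_iff.mp hu).2]) _
        have c4 : Commute (u ^ (j : ℕ)) u := Commute.pow_left rfl _
        calc v ^ (k : ℕ) * u ^ (j : ℕ) * (star u ^ (j' : ℕ) * star v ^ (k' : ℕ)) * u
            = v ^ (k : ℕ) * (u ^ (j : ℕ) * (star u ^ (j' : ℕ) * (star v ^ (k' : ℕ) * u))) := by
              simp only [mul_assoc]
          _ = ζ ^ (k' : ℕ) • (v ^ (k : ℕ) * (u ^ (j : ℕ) * (star u ^ (j' : ℕ) * u) *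
              star v ^ (k' : ℕ))) := by
              rw [c1]; simp only [mul_smul_comm, mul_assoc]
          _ = ζ ^ (k' : ℕ) • ((v ^ (k : ℕ) * u) * (u ^ (j : ℕ) * star u ^ (j' : ℕ) *
              star v ^ (k' : ℕ))) := by
              rw [c3.eq, ← mul_assoc (u ^ (j : ℕ)), c4.eq]; simp only [mul_assoc]
          _ = _ := by
              rw [c2, smul_mul_assoc, smul_smul, mul_comm (ζ ^ _)]; simp only [mul_assoc]
    rw [hz, mul_zero]

theorem hilbertSchmidtRep_matU (p q j k : ℕ) :
    hilbertSchmidtRep q (matU q) (weylVec p q (j + 1) k) = weylVec p q j k := by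
  rw [weylVec, map_smul, hilbertSchmidtRep_vecHS, pow_succ', ← mul_assoc, ← mul_assoc,
    (Unitary.mem_iff.mp (matU_mem_unitary q)).2, one_mul, weylVec]

theorem hilbertSchmidtRep_matV (p q j k : ℕ) :
    hilbertSchmidtRep q (matV p q) (weylVec p q j (k + 1)) =
      expRot ((p : ℝ) / q) ^ j • weylVec p q j k := by
  have c := mul_eq_inv_smul_of_comm (expRot_ne_zero _)
    (mul_star_eq_of_comm (matU_mem_unitary q) (matU_mul_matV p q))
  have c1 := mul_eq_inv_smul_of_comm (pow_ne_zero j (inv_ne_zero (expRot_ne_zero _)))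
    (commute_pow_mul c j)
  rw [inv_pow, inv_inv] at c1
  rw [weylVec, map_smul, hilbertSchmidtRep_vecHS, ← mul_assoc, c1, smul_mul_assoc, pow_succ',
    mul_assoc, ← mul_assoc (matV p q), (Unitary.mem_iff.mp (matV_mem_unitary p q)).2, one_mul,
    vecHS_smul, smul_comm, weylVec]

/-! ### The rotation pair on `ℓ²(ℤ²)` -/

/-- The Hilbert space `ℓ²(ℤ²)`. -/
abbrev EllTwo : Type := lp (fun _ : ℤ × ℤ => ℂ) 2

/-- The weighted permutation operator `(T f)(i) = m(i) f(σ i)`. -/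
def weightedPerm (σ : Equiv.Perm (ℤ × ℤ)) (m : ℤ × ℤ → ℂ) (hm : ∀ i, ‖m i‖ = 1) :
    EllTwo →ₗᵢ[ℂ] EllTwo where
  toFun f := ⟨fun i => m i * f (σ i), memℓp_gen (by
    have h := (lp.memℓp f).summable (by norm_num)
    simpa [hm, Function.comp_def] using (Equiv.summable_iff σ).mpr h)⟩
  map_add' f g := by
    apply lp.ext; funext i
    exact mul_add _ _ _
  map_smul' c f := by
    apply lp.ext; funext i
    exact mul_left_comm _ _ _
  norm_map' f := by
    rw [lp.norm_eq_tsum_rpow (by norm_num), lp.norm_eq_tsum_rpow (by norm_num)]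
    congr 1
    simpa [hm] using Equiv.tsum_eq σ fun i => ‖f i‖ ^ (2 : ℝ≥0∞).toReal

theorem weightedPerm_apply (σ : Equiv.Perm (ℤ × ℤ)) (m : ℤ × ℤ → ℂ) (hm : ∀ i, ‖m i‖ = 1)
    (f : EllTwo) (i : ℤ × ℤ) : weightedPerm σ m hm f i = m i * f (σ i) := rfl

theorem weightedPerm_surjective (σ : Equiv.Perm (ℤ × ℤ)) (m : ℤ × ℤ → ℂ) (hm : ∀ i, ‖m i‖ = 1) :
    Function.Surjective (weightedPerm σ m hm) := by
  intro f
  refine ⟨weightedPerm σ.symm (fun i => (m (σ.symm i))⁻¹) (by simp [hm]) f, ?_⟩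
  apply lp.ext; funext i
  have : m i ≠ 0 := by rw [← norm_ne_zero_iff, hm]; exact one_ne_zero
  rw [weightedPerm_apply, weightedPerm_apply]
  simp [this]

/-- The weighted permutation operator as a unitary. -/
def weightedPermUnitary (σ : Equiv.Perm (ℤ × ℤ)) (m : ℤ × ℤ → ℂ) (hm : ∀ i, ‖m i‖ = 1) :
    unitary (EllTwo →L[ℂ] EllTwo) :=
  Unitary.linearIsometryEquiv.symm
    (LinearIsometryEquiv.ofSurjective _ (weightedPerm_surjective σ m hm))

instance : Nontrivial EllTwo :=
  ⟨⟨lp.single 2 0 1, 0, fun h => by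
    have := congrArg (fun f : EllTwo => f 0) h
    simp at this⟩⟩

/-- The shift in the first variable. -/
def latticeU : unitary (EllTwo →L[ℂ] EllTwo) :=
  weightedPermUnitary ((Equiv.addRight (1 : ℤ)).prodCongr (Equiv.refl ℤ)) (fun _ => 1) (by simp)

/-- The modulated shift in the second variable. -/
def latticeV (θ : ℝ) : unitary (EllTwo →L[ℂ] EllTwo) :=
  weightedPermUnitary ((Equiv.refl ℤ).prodCongr (Equiv.addRight (1 : ℤ)))
    (fun i => expRot θ ^ i.1) (by simp [norm_expRot])

/-- The rotation pair on `ℓ²(ℤ²)`. -/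
def latticePair (θ : ℝ) : RotationPair θ where
  carrier := EllTwo →L[ℂ] EllTwo
  U := latticeU
  V := latticeV θ
  U_mem := Subtype.property _
  V_mem := Subtype.property _
  comm := by
    refine ContinuousLinearMap.ext fun f => lp.ext (funext fun i => ?_)
    change (1 : ℂ) * (expRot θ ^ (i.1 + 1) * f (i.1 + 1, i.2 + 1)) =
      expRot θ * (expRot θ ^ i.1 * (1 * f (i.1 + 1, i.2 + 1)))
    rw [zpow_add_one₀ (expRot_ne_zero θ)]
    ring

/-- The standard basis vectors of `ℓ²(ℤ²)` with indices in `ℕ²`. -/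
def latticeVec (j k : ℕ) : EllTwo := lp.single 2 ((j : ℤ), (k : ℤ)) 1

theorem orthonormal_latticeVec (q : ℕ) :
    Orthonormal ℂ fun s : Fin q × Fin q => latticeVec s.1 s.2 := by
  rw [orthonormal_iff_ite]
  rintro ⟨j, k⟩ ⟨j', k'⟩
  rw [latticeVec, latticeVec, lp.inner_single_left, lp.single_apply]
  by_cases h : j = j' ∧ k = k'
  · obtain ⟨rfl, rfl⟩ := h
    simp
  · have h1 : ((j : ℤ), (k : ℤ)) ≠ ((j' : ℤ), (k' : ℤ)) := by
      intro h2
      rw [Prod.mk.injEq] at h2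
      exact h ⟨Fin.ext (by exact_mod_cast h2.1), Fin.ext (by exact_mod_cast h2.2)⟩
    rw [Pi.single_eq_of_ne h1, if_neg (by simpa [Prod.ext_iff] using h)]
    simp

theorem latticeU_latticeVec (j k : ℕ) :
    (latticeU : EllTwo →L[ℂ] EllTwo) (latticeVec (j + 1) k) = latticeVec j k := by
  refine lp.ext (funext fun i => ?_)
  change (1 : ℂ) * (latticeVec (j + 1) k : ℤ × ℤ → ℂ) (i.1 + 1, i.2) = _
  simp only [latticeVec, lp.single_apply, Pi.single_apply, Prod.ext_iff]
  simp

theorem latticeV_latticeVec (θ : ℝ) (j k : ℕ) :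
    (latticeV θ : EllTwo →L[ℂ] EllTwo) (latticeVec j (k + 1)) =
      expRot θ ^ j • latticeVec j k := by
  refine lp.ext (funext fun i => ?_)
  change expRot θ ^ i.1 * (latticeVec j (k + 1) : ℤ × ℤ → ℂ) (i.1, i.2 + 1) =
    expRot θ ^ j * (latticeVec j k : ℤ × ℤ → ℂ) i
  simp only [latticeVec, lp.single_apply, Pi.single_apply, Prod.ext_iff]
  by_cases h : i.1 = j ∧ i.2 = k
  · simp [h.1, h.2]
  · rw [if_neg (by simpa using h), if_neg (by simpa using h)]
    simp

/-! ### Convergents -/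

theorem completeQuotient_succ (θ : ℝ) (n : ℕ) :
    completeQuotient θ (n + 1) = (Int.fract (completeQuotient θ n))⁻¹ := by
  rw [completeQuotient, one_div, Int.self_sub_floor]

theorem irrational_completeQuotient {θ : ℝ} (hθ : Irrational θ) (n : ℕ) :
    Irrational (completeQuotient θ n) := by
  induction n with
  | zero => exact hθ
  | succ n ih =>
    rw [completeQuotient_succ, ← Int.self_sub_floor]
    exact (ih.sub_intCast _).inv

theorem fract_completeQuotient_pos {θ : ℝ} (hθ : Irrational θ) (n : ℕ) :
    0 < Int.fract (completeQuotient θ n) :=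
  Int.fract_pos.mpr ((irrational_completeQuotient hθ n).ne_int _)

theorem one_lt_completeQuotient_succ {θ : ℝ} (hθ : Irrational θ) (n : ℕ) :
    1 < completeQuotient θ (n + 1) := by
  rw [completeQuotient_succ]
  exact (one_lt_inv₀ (fract_completeQuotient_pos hθ n)).mpr (Int.fract_lt_one _)

theorem completeQuotient_succ_eq {θ : ℝ} (hθ : Irrational θ) (n : ℕ) :
    completeQuotient θ (n + 1) =
      partialQuotient θ (n + 1) + (completeQuotient θ (n + 2))⁻¹ := by
  rw [completeQuotient_succ θ (n + 1), inv_inv, partialQuotient,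
    natCast_floor_eq_intCast_floor (by linarith [one_lt_completeQuotient_succ hθ n])]
  exact (Int.floor_add_fract _).symm

theorem partialQuotient_succ_pos {θ : ℝ} (hθ : Irrational θ) (n : ℕ) :
    1 ≤ partialQuotient θ (n + 1) :=
  Nat.le_floor (by exact_mod_cast (one_lt_completeQuotient_succ hθ n).le)

theorem convDen_pos {θ : ℝ} (hθ : Irrational θ) (n : ℕ) : 1 ≤ convDen θ n := by
  induction n using Nat.twoStepInduction with
  | zero => exact le_rfl
  | one => exact partialQuotient_succ_pos hθ 0
  | more n ih _ => rw [convDen]; omega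

theorem convNum_mul_convDen_sub (θ : ℝ) (n : ℕ) :
    (convNum θ (n + 1) : ℤ) * convDen θ n - convNum θ n * convDen θ (n + 1) = (-1) ^ n := by
  induction n with
  | zero => simp [convNum, convDen]
  | succ n ih =>
    rw [convNum, convDen, pow_succ, ← ih]
    push_cast
    ring

theorem coprime_convNum_convDen (θ : ℝ) (n : ℕ) : (convNum θ n).Coprime (convDen θ n) := by
  rw [← Nat.isCoprime_iff_coprime]
  refine ⟨-(-1) ^ n * convDen θ (n + 1), (-1) ^ n * convNum θ (n + 1), ?_⟩
  have h := convNum_mul_convDen_sub θ n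
  have h2 : ((-1 : ℤ) ^ n) * (-1) ^ n = 1 := by rw [← mul_pow]; simp
  linear_combination (-1) ^ n * h + h2

theorem mul_completeQuotient_eq {θ : ℝ} (hθ : Irrational θ) (h0 : 0 < θ) (h1 : θ < 1) (n : ℕ) :
    θ * (convDen θ (n + 1) * completeQuotient θ (n + 2) + convDen θ n) =
      convNum θ (n + 1) * completeQuotient θ (n + 2) + convNum θ n := by
  induction n with
  | zero =>
    have e := completeQuotient_succ_eq hθ 0
    have e1 : completeQuotient θ 1 = θ⁻¹ := by
      rw [completeQuotient_succ, completeQuotient, Int.fract_eq_self.mpr ⟨h0.le, h1⟩]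
    have hpos : 0 < completeQuotient θ 2 := by linarith [one_lt_completeQuotient_succ hθ 1]
    rw [zero_add, e1] at e
    simp only [zero_add, convNum, convDen, Nat.cast_one, Nat.cast_zero, one_mul, add_zero]
    have e2 : (partialQuotient θ 1 : ℝ) = θ⁻¹ - (completeQuotient θ 2)⁻¹ := by linarith
    rw [e2]
    field_simp
    ring
  | succ n ih =>
    have e := completeQuotient_succ_eq hθ (n + 1)
    have hpos : 0 < completeQuotient θ (n + 3) := by
      linarith [one_lt_completeQuotient_succ hθ (n + 2)]
    rw [e] at ih
    simp only [convNum, convDen]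
    push_cast
    field_simp at ih
    linear_combination ih

/-- For a positive index, the Möbius expression of `θ` through the next complete quotient `t` and
the determinant identity give an error `±1/(qD)`, where `D = qt + q'` with `q'` the preceding
denominator; `D ≥ q` because `t > 1`. -/
theorem abs_sub_convergent_le {θ : ℝ} (hθ : Irrational θ) (h0 : 0 < θ) (h1 : θ < 1) (n : ℕ) :
    |(convNum θ n : ℝ) / convDen θ n - θ| ≤ 1 / (convDen θ n : ℝ) ^ 2 := by
  cases n with
  | zero => simp [convNum, convDen, abs_of_pos h0, h1.le]
  | succ n =>
    have hq : (1 : ℝ) ≤ convDen θ (n + 1) := by exact_mod_cast convDen_pos hθ (n + 1)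
    have hq' : (1 : ℝ) ≤ convDen θ n := by exact_mod_cast convDen_pos hθ n
    have ht := one_lt_completeQuotient_succ hθ (n + 1)
    have key := mul_completeQuotient_eq hθ h0 h1 n
    have hdet : (convNum θ (n + 1) : ℝ) * convDen θ n - convNum θ n * convDen θ (n + 1) =
      (-1) ^ n := by exact_mod_cast convNum_mul_convDen_sub θ n
    set t := completeQuotient θ (n + 1 + 1)
    set D : ℝ := convDen θ (n + 1) * t + convDen θ n with hD
    have hDq : (convDen θ (n + 1) : ℝ) ≤ D := by nlinarith
    have hDpos : 0 < D := by linarith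
    have e : (convNum θ (n + 1) : ℝ) / convDen θ (n + 1) - θ =
        (-1) ^ n / (convDen θ (n + 1) * D) := by
      rw [← hdet, eq_div_iff (by positivity)]
      have hq0 : (convDen θ (n + 1) : ℝ) ≠ 0 := by positivity
      rw [sub_mul, ← mul_assoc, div_mul_cancel₀ _ hq0]
      linear_combination (-(convDen θ (n + 1) : ℝ)) * key + (convNum θ (n + 1) : ℝ) * hD
    rw [e, abs_div, abs_pow, abs_neg, abs_one, one_pow, abs_of_pos (by positivity), sq]
    gcongr

/-! ### Comparison of the pseudospectra -/

instance (θ : ℝ) : Nontrivial (RotationAlgebra θ) :=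
  ⟨⟨1, 0, fun h => by
    have h1 := congrArg (evalHom (latticePair θ)) h
    rw [map_one, map_zero] at h1
    exact one_ne_zero h1⟩⟩

theorem norm_expRot_pow_sub_convergent_le {θ : ℝ} (hθ : Irrational θ) (h0 : 0 < θ) (h1 : θ < 1)
    (n : ℕ) {j : ℕ} (hj : j < convDen θ n) :
    ‖expRot ((convNum θ n : ℝ) / convDen θ n) ^ j - expRot θ ^ j‖ ≤ 7 / convDen θ n := by
  have hq : (1 : ℝ) ≤ convDen θ n := by exact_mod_cast convDen_pos hθ n
  have hj' : (j : ℝ) ≤ convDen θ n := by exact_mod_cast hj.le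
  refine (norm_expRot_pow_sub_le _ _ _).trans ?_
  have hpi : 2 * Real.pi ≤ 7 := by linarith [Real.pi_lt_d2]
  calc 2 * Real.pi * j * |(convNum θ n : ℝ) / convDen θ n - θ|
      ≤ 7 * convDen θ n * (1 / (convDen θ n : ℝ) ^ 2) := by
        gcongr
        exact abs_sub_convergent_le hθ h0 h1 n
    _ = 7 / convDen θ n := by field_simp

section Comparison

variable {θ : ℝ} (hθ : Irrational θ) (h0 : 0 < θ) (h1 : θ < 1) (α₁ α₁' β₁ β₁' : ℂ) (n : ℕ)
  {δ η : ℝ} (hδ : 0 < δ)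
  (hη : δ + 4 * maxCoeff α₁ α₁' β₁ β₁' * (11 / convDen θ n) ≤ η)
include hθ h0 h1 hδ hη

/-- Here `Φ` maps matrices to `A_θ`, carrying matrix resolvents to approximate resolvents of `H_θ`.
-/
theorem pseudospectrum_opH_subset :
    pseudospectrum δ (opH θ α₁ α₁' β₁ β₁') ⊆ pseudospectrum η (matH θ α₁ α₁' β₁ β₁' n) := by
  have hq := convDen_pos hθ n
  have : Nonempty (Fin (convDen θ n)) := ⟨⟨0, hq⟩⟩
  obtain ⟨Φ, hΦ⟩ := exists_isApproxHom (π := hilbertSchmidtRep (convDen θ n))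
    (ξ := weylVec (convNum θ n) (convDen θ n)) (B := RotationAlgebra θ) hq
    (matU_mem_unitary _) (matV_mem_unitary (convNum θ n) _)
    (genU_mem_unitary θ) (genV_mem_unitary θ) (ζ := expRot θ) (gen_comm θ) (norm_expRot _)
    (fun j hj => norm_expRot_pow_sub_convergent_le hθ h0 h1 n hj)
    (hilbertSchmidtRep_matU _ _) (hilbertSchmidtRep_matV _ _)
    (orthonormal_weylVec hq (coprime_convNum_convDen θ n))
  exact hΦ.pseudospectrum_subset (by positivity) (matU_mem_unitary _) (matV_mem_unitary _ _)
    (genU_mem_unitary θ) (genV_mem_unitary θ) α₁ α₁' β₁ β₁' hδ hη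

/-- Here `Φ` maps `A_θ` to matrices. The lattice representation need not be known to be faithful:
only a *-homomorphism with the right orthonormal vectors is needed. -/
theorem pseudospectrum_matH_subset :
    pseudospectrum δ (matH θ α₁ α₁' β₁ β₁' n) ⊆ pseudospectrum η (opH θ α₁ α₁' β₁ β₁') := by
  have hq := convDen_pos hθ n
  have : Nonempty (Fin (convDen θ n)) := ⟨⟨0, hq⟩⟩
  obtain ⟨Φ, hΦ⟩ := exists_isApproxHom (π := evalHom (latticePair θ)) (ξ := latticeVec)
    (B := Matrix (Fin (convDen θ n)) (Fin (convDen θ n)) ℂ) hq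
    (genU_mem_unitary θ) (genV_mem_unitary θ) (matU_mem_unitary _) (matV_mem_unitary _ _)
    (matU_mul_matV (convNum θ n) (convDen θ n)) (norm_expRot θ)
    (fun j hj => by
      rw [norm_sub_rev]
      exact norm_expRot_pow_sub_convergent_le hθ h0 h1 n hj)
    latticeU_latticeVec (latticeV_latticeVec θ) (orthonormal_latticeVec _)
  exact hΦ.pseudospectrum_subset (by positivity) (genU_mem_unitary θ) (genV_mem_unitary θ)
    (matU_mem_unitary _) (matV_mem_unitary _ _) α₁ α₁' β₁ β₁' hδ hη

end Comparison

/-! ### Normal elements -/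

/-- The resolvent of a normal element is normal, so its norm is attained as `|μ|` for a spectral
value `μ`; the point `z - μ⁻¹` is then in the spectrum of `T`, at distance `1/‖(z - T)⁻¹‖ ≤ ε`. -/
theorem exists_spectrum_norm_sub_le {A : Type*} [CStarAlgebra A] [Nontrivial A] {T : A}
    (hT : IsStarNormal T) {ε : ℝ} (hε : 0 < ε) {z : ℂ} (hz : z ∈ pseudospectrum ε T) :
    ∃ w ∈ spectrum ℂ T, ‖z - w‖ ≤ ε := by
  by_cases hu : IsUnit (algebraMap ℂ A z - T)
  · have hz' : 1 / ε ≤ ‖Ring.inverse (algebraMap ℂ A z - T)‖ := hz.resolve_left (not_not.mpr hu)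
    obtain ⟨x, hx⟩ := hu
    rw [← hx, Ring.inverse_unit] at hz'
    have hxn : IsStarNormal (x : A) := by
      rw [hx]
      refine ⟨?_⟩
      have h1 : Commute (star T) T := hT.star_comm_self
      rw [star_sub, ← algebraMap_star_comm]
      exact (Algebra.commute_algebraMap_left _ _).sub_left
        ((Algebra.commute_algebraMap_right _ _).sub_right h1)
    have hinv : IsStarNormal ((x⁻¹ : Aˣ) : A) := by
      refine ⟨?_⟩
      have h2 : Commute ((star x : Aˣ) : A) (x : A) := hxn.star_comm_self
      have h3 : Commute (star x) x := Units.ext h2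
      have h4 := h3.inv_inv
      have h5 : star (x⁻¹) * x⁻¹ = x⁻¹ * star (x⁻¹) := by
        rw [star_inv]; exact h4
      exact congrArg Units.val h5
    obtain ⟨μ, hμ, hμn⟩ := spectrum.exists_nnnorm_eq_spectralRadius ((x⁻¹ : Aˣ) : A)
    rw [hinv.spectralRadius_eq_nnnorm] at hμn
    have hμn' : ‖μ‖ = ‖((x⁻¹ : Aˣ) : A)‖ := by
      have := ENNReal.coe_inj.mp hμn
      exact congrArg NNReal.toReal this
    have hμ0 : μ ≠ 0 := by
      rw [← norm_ne_zero_iff, hμn']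
      exact ne_of_gt (lt_of_lt_of_le (by positivity) hz')
    have hmem : μ⁻¹ ∈ spectrum ℂ (x : A) := by
      have := spectrum.inv₀_mem_iff.mpr (by simpa using hμ : μ ∈ spectrum ℂ ((x⁻¹ : Aˣ) : A))
      simpa using this
    rw [hx, spectrum.mem_iff] at hmem
    refine ⟨z - μ⁻¹, ?_, ?_⟩
    · rw [spectrum.mem_iff]
      intro h
      apply hmem
      rw [← IsUnit.neg_iff]
      convert h using 1
      rw [map_sub]
      abel
    · rw [sub_sub_cancel, norm_inv, hμn']
      exact inv_le_of_inv_le₀ hε (by simpa using hz')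
  · exact ⟨z, hu, by simpa using hε.le⟩

theorem spectrum_subset_pseudospectrum {A : Type*} [NormedRing A] [NormedAlgebra ℂ A] (ε : ℝ)
    (T : A) : spectrum ℂ T ⊆ pseudospectrum ε T := fun _ hz => Or.inl hz

theorem infEDist_spectrum_le {A : Type*} [CStarAlgebra A] [Nontrivial A] {T : A}
    (hT : IsStarNormal T) {r : ℝ} (hr : 0 ≤ r) {z : ℂ}
    (hz : ∀ ε : ℝ, 0 < ε → z ∈ pseudospectrum (ε + r) T) :
    Metric.infEDist z (spectrum ℂ T) ≤ ENNReal.ofReal r := by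
  refine ENNReal.le_of_forall_pos_le_add fun ε hε _ => ?_
  obtain ⟨w, hw, hzw⟩ := exists_spectrum_norm_sub_le hT (by positivity) (hz ε hε)
  refine (Metric.infEDist_le_edist_of_mem hw).trans ?_
  rw [edist_dist, dist_eq_norm, ← ENNReal.ofReal_coe_nnreal, ← ENNReal.ofReal_add hr (by positivity),
    add_comm r]
  exact ENNReal.ofReal_le_ofReal hzw

theorem mul_convDen_le_errBound {θ : ℝ} (α₁ α₁' β₁ β₁' : ℂ) {n m : ℕ} (hm : m = n - 1 ∨ m = n) :
    4 * maxCoeff α₁ α₁' β₁ β₁' * (11 / convDen θ m) ≤ errBound θ α₁ α₁' β₁ β₁' n := by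
  have hM := maxCoeff_nonneg α₁ α₁' β₁ β₁'
  have e : errBound θ α₁ α₁' β₁ β₁' n = 204 * maxCoeff α₁ α₁' β₁ β₁' *
    (1 / (convDen θ (n - 1) : ℝ) + 1 / (convDen θ n : ℝ)) := rfl
  have h1 : 1 / (convDen θ m : ℝ) ≤ 1 / (convDen θ (n - 1) : ℝ) + 1 / (convDen θ n : ℝ) := by
    rcases hm with rfl | rfl
    · exact le_add_of_nonneg_right (by positivity)
    · exact le_add_of_nonneg_left (by positivity)
  have h2 : 0 ≤ 1 / (convDen θ m : ℝ) := by positivity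
  calc 4 * maxCoeff α₁ α₁' β₁ β₁' * (11 / convDen θ m)
      = 44 * maxCoeff α₁ α₁' β₁ β₁' * (1 / convDen θ m) := by ring
    _ ≤ 204 * maxCoeff α₁ α₁' β₁ β₁' * (1 / convDen θ m) := by gcongr; norm_num
    _ ≤ _ := by rw [e]; gcongr

end RotationSpectra
end

/-! ### Assembly of the inclusions and the Hausdorff bound -/

open RotationSpectra in
theorem theorem4p1 (θ : ℝ) (hθ : Irrational θ) (h0 : 0 < θ) (h1 : θ < 1)
    (α₁ α₁' β₁ β₁' : ℂ) (n : ℕ) (hn : 1 ≤ n) :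
    (∀ ε : ℝ, 0 < ε →
      pseudospectrum ε (matH θ α₁ α₁' β₁ β₁' (n - 1)) ∪
          pseudospectrum ε (matH θ α₁ α₁' β₁ β₁' n) ⊆
        pseudospectrum (ε + errBound θ α₁ α₁' β₁ β₁' n) (opH θ α₁ α₁' β₁ β₁') ∧
      pseudospectrum (ε + errBound θ α₁ α₁' β₁ β₁' n) (opH θ α₁ α₁' β₁ β₁') ⊆
        pseudospectrum (ε + 2 * errBound θ α₁ α₁' β₁ β₁' n) (matH θ α₁ α₁' β₁ β₁' (n - 1)) ∪
          pseudospectrum (ε + 2 * errBound θ α₁ α₁' β₁ β₁' n) (matH θ α₁ α₁' β₁ β₁' n)) ∧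
    (IsStarNormal (matH θ α₁ α₁' β₁ β₁' (n - 1)) →
      IsStarNormal (matH θ α₁ α₁' β₁ β₁' n) →
      IsStarNormal (opH θ α₁ α₁' β₁ β₁') →
      Metric.hausdorffEDist
          (spectrum ℂ (matH θ α₁ α₁' β₁ β₁' (n - 1)) ∪ spectrum ℂ (matH θ α₁ α₁' β₁ β₁' n))
          (spectrum ℂ (opH θ α₁ α₁' β₁ β₁')) ≤
        ENNReal.ofReal (errBound θ α₁ α₁' β₁ β₁' n)) := by
  have hr1 := mul_convDen_le_errBound (θ := θ) α₁ α₁' β₁ β₁' (n := n) (Or.inl rfl)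
  have hr2 := mul_convDen_le_errBound (θ := θ) α₁ α₁' β₁ β₁' (n := n) (Or.inr rfl)
  have hr : 0 ≤ errBound θ α₁ α₁' β₁ β₁' n := by
    have := maxCoeff_nonneg α₁ α₁' β₁ β₁'
    exact le_trans (by positivity) hr2
  set r := errBound θ α₁ α₁' β₁ β₁' n
  refine ⟨fun ε hε => ⟨Set.union_subset ?_ ?_, ?_⟩, fun hN1 hN2 hN => ?_⟩
  · exact pseudospectrum_matH_subset hθ h0 h1 _ _ _ _ _ hε (by gcongr)
  · exact pseudospectrum_matH_subset hθ h0 h1 _ _ _ _ _ hε (by gcongr)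
  -- The matrix of index `n` alone already covers the pseudospectrum of `H_θ`.
  · exact (pseudospectrum_opH_subset hθ h0 h1 _ _ _ _ n (by positivity)
      (by linarith)).trans Set.subset_union_right
  · have : Nonempty (Fin (convDen θ n)) := ⟨⟨0, convDen_pos hθ n⟩⟩
    refine Metric.hausdorffEDist_le_of_infEDist ?_ ?_
    -- A spectral point lies in the `ε`-pseudospectrum for every `ε > 0`, so the transported
    -- inclusions hold with arbitrarily small `ε`.
    · rintro z (hz | hz)
      · exact infEDist_spectrum_le hN hr fun ε hε =>
          pseudospectrum_matH_subset hθ h0 h1 _ _ _ _ (n - 1) hε (by gcongr)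
            (spectrum_subset_pseudospectrum _ _ hz)
      · exact infEDist_spectrum_le hN hr fun ε hε =>
          pseudospectrum_matH_subset hθ h0 h1 _ _ _ _ n hε (by gcongr)
            (spectrum_subset_pseudospectrum _ _ hz)
    · intro z hz
      refine (Metric.infEDist_anti Set.subset_union_right).trans ?_
      exact infEDist_spectrum_le hN2 hr fun ε hε =>
        pseudospectrum_opH_subset hθ h0 h1 _ _ _ _ n hε (by gcongr)
          (spectrum_subset_pseudospectrum _ _ hz)
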